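/- Let $\Lambda$ be an arbitrary set, of cardinality $d$. For a tuple $T=(T_i)_{i\in\Lambda}$ of complex $n\times n$ matrices let $\|T\|=\|\sum_{i}T_iT_i^*\|^{1/2}\in[0,\infty]$ be its row norm (the supremum over finite subsets of $\Lambda$ of $\|\sum_{i}T_iT_i^*\|^{1/2}$), and let $\mathfrak B_d=\bigsqcup_{n\ge 1}\{T\in M_n(\mathbb C)^\Lambda:\|T\|<1\}$ be the noncommutative open unit ball. A noncommutative function on $\mathfrak B_d$ is a map $f$ that sends points of $\mathfrak B_d$ of size $n$ to $n\times n$ matrices, with $f(X\oplus Y)=f(X)\oplus f(Y)$ for all $X,Y\in\mathfrak B_d$, and $f(S^{-1}XS)=S^{-1}f(X)S$ whenever $S$ is an invertible matrix and $X,\,S^{-1}XS\in\mathfrak B_d$. Let $A_d$ be the algebra, with pointwise operations, of all noncommutative functions $f$ on $\mathfrak B_d$ that are uniformly continuous: for every $\varepsilon>0$ there is $\delta>0$ such that $\|f(X)-f(Y)\|<\varepsilon$ for all $n$ and all $X,Y\in\mathfrak B_d$ of size $n$ with $\|X-Y\|<\delta$. Such functions are bounded; closures in $A_d$ are taken in the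 supremum norm over $\mathfrak B_d$. Let $z_i\in A_d$, $z_i(T)=T_i$, be the coordinate functions. A monomial is a finite (possibly empty) product $z_{i_1}\cdots z_{i_k}$, and a homogeneous polynomial of degree $k$ is a finite linear combination of monomials of length $k$. A two-sided ideal $J\subseteq A_d$ is homogeneous if, for every $f\in J$ and every integer $k\ge 0$, the function \[ f_k(X)=\frac1{2\pi}\int_0^{2\pi}f(e^{i\theta}X)\,e^{-ik\theta}\,d\theta \] belongs to $J$; it is generated by a set $E\subseteq A_d$ if it is the closure of the two-sided ideal of $A_d$ generated by $E$ algebraically. For $J\subseteq A_d$ and $\Omega\subseteq\mathfrak B_d$ put \[ V(J)=\{X\in\mathfrak B_d: f(X)=0\text{ for all }f\in J\},\qquad I(\Omega)=\{f\in A_d: f(X)=0\text{ for all }X\in\Omega\}. \] \textbf{Theorem.} Let $J$ be a closed homogeneous two-sided ideal of $A_d$. Suppose that $J$ is generated by a set of monomials, or that there is a finite subset $\Lambda'\subseteq\Lambda$ such that $J$ is generated by a set of homogeneous polynomials in the variables $(z_i)_{i\in\Lambda'}$. Then \[ J=I(V(J)). \] -/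

import Mathlib

open scoped Matrix ENNReal Matrix.Norms.L2Operator

noncomputable section

namespace NCBall

universe u

/-- Tuples `T = (T i)_{i ∈ Λ}` of complex `n × n` matrices, indexed by an arbitrary set `Λ`. -/
abbrev Tuple (Λ : Type u) (n : ℕ) : Type u := Λ → Matrix (Fin n) (Fin n) ℂ

/-- The row norm of a tuple, `‖∑ i, T i (T i)*‖ ^ (1/2)`, i.e. the norm of the row operator
`⨁_{i ∈ Λ} ℂⁿ → ℂⁿ`. For infinite `Λ` it is the supremum over the finite subtuples; the value is
`∞` exactly when the tuple does not define a bounded operator. Norms of matrices are operator norms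
with respect to the Euclidean norm. -/
def rowNorm {Λ : Type u} {n : ℕ} (T : Tuple Λ n) : ℝ≥0∞ :=
  ⨆ s : Finset Λ, ENNReal.ofReal (Real.sqrt ‖∑ i ∈ s, T i * (T i)ᴴ‖)

/-- The level `n` of the noncommutative open unit ball (`n ≥ 1`): strict row contractions. -/
def ballLevel (Λ : Type u) (n : ℕ) : Set (Tuple Λ n) := {T | 0 < n ∧ rowNorm T < 1}

/-- The noncommutative open unit ball: the disjoint union of its levels. -/
abbrev Ball (Λ : Type u) : Type u := Σ n : ℕ, ballLevel Λ n

/-- Graded functions on the noncommutative open unit ball, with the pointwise operations. -/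
abbrev GradedFun (Λ : Type u) : Type u := (X : Ball Λ) → Matrix (Fin X.1) (Fin X.1) ℂ

/-- The direct sum of two square matrices, as a block diagonal matrix. -/
def dirSum {m n : ℕ} (A : Matrix (Fin m) (Fin m) ℂ) (B : Matrix (Fin n) (Fin n) ℂ) :
    Matrix (Fin (m + n)) (Fin (m + n)) ℂ :=
  Matrix.reindex finSumFinEquiv finSumFinEquiv (Matrix.fromBlocks A 0 0 B)

/-- Noncommutative functions on the ball: graded functions that respect direct sums and
similarities. (`Z` is the direct sum of `X` and `Y`; the ball is closed under direct sums.) -/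
structure IsNC {Λ : Type u} (f : GradedFun Λ) : Prop where
  map_dirSum : ∀ (m n : ℕ) (X : ballLevel Λ m) (Y : ballLevel Λ n) (Z : ballLevel Λ (m + n)),
    (∀ i, Z.1 i = dirSum (X.1 i) (Y.1 i)) → f ⟨m + n, Z⟩ = dirSum (f ⟨m, X⟩) (f ⟨n, Y⟩)
  map_similar : ∀ (n : ℕ) (S : (Matrix (Fin n) (Fin n) ℂ)ˣ) (X Y : ballLevel Λ n),
    (∀ i, Y.1 i = (↑S⁻¹ : Matrix (Fin n) (Fin n) ℂ) * X.1 i * (↑S : Matrix (Fin n) (Fin n) ℂ)) →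
      f ⟨n, Y⟩ =
        (↑S⁻¹ : Matrix (Fin n) (Fin n) ℂ) * f ⟨n, X⟩ * (↑S : Matrix (Fin n) (Fin n) ℂ)

/-- Uniform continuity with respect to the row norm, uniformly over all levels. -/
def IsUnifCont {Λ : Type u} (f : GradedFun Λ) : Prop :=
  ∀ ε : ℝ, 0 < ε → ∃ δ : ℝ, 0 < δ ∧ ∀ (n : ℕ) (X Y : ballLevel Λ n),
    rowNorm (X.1 - Y.1) < ENNReal.ofReal δ → ‖f ⟨n, X⟩ - f ⟨n, Y⟩‖ < ε

lemma rowNorm_smul {Λ : Type u} {n : ℕ} (c : ℂ) (T : Tuple Λ n) :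
    rowNorm (c • T) = ENNReal.ofReal ‖c‖ * rowNorm T := by
  unfold rowNorm
  rw [ENNReal.mul_iSup]
  refine iSup_congr fun s => ?_
  rw [← ENNReal.ofReal_mul (norm_nonneg c)]
  congr 1
  have h : ∑ i ∈ s, (c • T) i * ((c • T) i)ᴴ = (c * star c) • ∑ i ∈ s, T i * (T i)ᴴ := by
    rw [Finset.smul_sum]
    refine Finset.sum_congr rfl fun i _ => ?_
    simp [Matrix.conjTranspose_smul, smul_smul, mul_comm]
  rw [h, norm_smul, norm_mul, norm_star, Real.sqrt_mul (by positivity),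
    Real.sqrt_mul_self (norm_nonneg c)]

lemma rowNorm_zero {Λ : Type u} {n : ℕ} : rowNorm (0 : Tuple Λ n) = 0 := by
  simp [rowNorm]

lemma norm_le_of_rowNorm_lt {Λ : Type u} {n : ℕ} {T : Tuple Λ n} {δ : ℝ}
    (h : rowNorm T < ENNReal.ofReal δ) (i : Λ) : ‖T i‖ < δ := by
  have h1 : ENNReal.ofReal (Real.sqrt ‖∑ j ∈ {i}, T j * (T j)ᴴ‖) < ENNReal.ofReal δ :=
    lt_of_le_of_lt (le_iSup (fun s : Finset Λ =>
      ENNReal.ofReal (Real.sqrt ‖∑ j ∈ s, T j * (T j)ᴴ‖)) {i}) h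
  have h2 : ‖T i * (T i)ᴴ‖ = ‖T i‖ * ‖T i‖ := by
    have := Matrix.l2_opNorm_conjTranspose_mul_self (T i)ᴴ
    rwa [Matrix.conjTranspose_conjTranspose, Matrix.l2_opNorm_conjTranspose] at this
  rw [Finset.sum_singleton, h2, Real.sqrt_mul_self (norm_nonneg _)] at h1
  exact (ENNReal.ofReal_lt_ofReal_iff_of_nonneg (norm_nonneg _)).1 h1

/-- Multiplication of a point of the ball by a scalar of modulus at most one. -/
def scale {Λ : Type u} {n : ℕ} (c : ℂ) (hc : ‖c‖ ≤ 1) (X : ballLevel Λ n) : ballLevel Λ n :=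
  ⟨c • X.1, X.2.1, by
    rw [rowNorm_smul]
    refine lt_of_le_of_lt ?_ X.2.2
    calc ENNReal.ofReal ‖c‖ * rowNorm X.1 ≤ 1 * rowNorm X.1 := by
          gcongr
          exact ENNReal.ofReal_le_one.2 hc
      _ = rowNorm X.1 := one_mul _⟩

lemma dirSum_smul_one {m n : ℕ} (c : ℂ) :
    dirSum (c • (1 : Matrix (Fin m) (Fin m) ℂ)) (c • (1 : Matrix (Fin n) (Fin n) ℂ)) = c • 1 := by
  have h : Matrix.fromBlocks (c • (1 : Matrix (Fin m) (Fin m) ℂ)) 0 0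
      (c • (1 : Matrix (Fin n) (Fin n) ℂ)) = c • 1 := by
    rw [← Matrix.fromBlocks_one, Matrix.fromBlocks_smul]
    simp
  unfold dirSum
  rw [h]
  ext i j
  simp [Matrix.one_apply]

lemma dirSum_zero {m n : ℕ} :
    dirSum (0 : Matrix (Fin m) (Fin m) ℂ) (0 : Matrix (Fin n) (Fin n) ℂ) = 0 := by
  simpa using dirSum_smul_one (m := m) (n := n) 0

lemma dirSum_add {m n : ℕ} (A A' : Matrix (Fin m) (Fin m) ℂ) (B B' : Matrix (Fin n) (Fin n) ℂ) :
    dirSum (A + A') (B + B') = dirSum A B + dirSum A' B' := by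
  have h : Matrix.fromBlocks (A + A') 0 0 (B + B') =
      Matrix.fromBlocks A 0 0 B + Matrix.fromBlocks A' 0 0 B' := by
    rw [Matrix.fromBlocks_add]
    simp
  unfold dirSum
  rw [h]
  rfl

lemma dirSum_mul {m n : ℕ} (A A' : Matrix (Fin m) (Fin m) ℂ) (B B' : Matrix (Fin n) (Fin n) ℂ) :
    dirSum (A * A') (B * B') = dirSum A B * dirSum A' B' := by
  have h : Matrix.fromBlocks (A * A') 0 0 (B * B') =
      Matrix.fromBlocks A 0 0 B * Matrix.fromBlocks A' 0 0 B' := by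
    rw [Matrix.fromBlocks_multiply]
    simp
  unfold dirSum
  rw [h]
  simp [Matrix.reindex_apply, Matrix.submatrix_mul_equiv]

/-- The zero tuple, as a point of a level of the ball. -/
def zeroPt (Λ : Type u) (n : ℕ) : ballLevel Λ (n + 1) :=
  ⟨0, Nat.succ_pos n, by rw [rowNorm_zero]; exact zero_lt_one⟩

lemma IsNC.apply_zero {Λ : Type u} {f : GradedFun Λ} (hf : IsNC f) :
    ∃ c : ℂ, ∀ n : ℕ, f ⟨n + 1, zeroPt Λ n⟩ = c • 1 := by
  refine ⟨f ⟨0 + 1, zeroPt Λ 0⟩ 0 0, fun n => ?_⟩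
  have h0 : f ⟨0 + 1, zeroPt Λ 0⟩ = (f ⟨0 + 1, zeroPt Λ 0⟩ 0 0) • 1 := by
    ext i j
    have hi : i = 0 := Subsingleton.elim (α := Fin 1) i 0
    have hj : j = 0 := Subsingleton.elim (α := Fin 1) j 0
    subst hi hj
    simp
  induction n with
  | zero => exact h0
  | succ n ih =>
    rw [hf.map_dirSum (n + 1) (0 + 1) (zeroPt Λ n) (zeroPt Λ 0) (zeroPt Λ (n + 1))
      (fun i => dirSum_zero.symm), ih]
    conv_lhs => rw [h0]
    simpa using dirSum_smul_one (m := n + 1) (n := 0 + 1) (f ⟨0 + 1, zeroPt Λ 0⟩ 0 0)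

/-- Uniformly continuous noncommutative functions on the ball are bounded. -/
lemma exists_bound {Λ : Type u} {f : GradedFun Λ} (hf : IsNC f) (hu : IsUnifCont f) :
    ∃ C : ℝ, ∀ X : Ball Λ, ‖f X‖ ≤ C := by
  obtain ⟨c, hc⟩ := hf.apply_zero
  obtain ⟨δ, hδ, h⟩ := hu 1 one_pos
  obtain ⟨N, hN⟩ := exists_nat_gt (1 / δ)
  have hNpos : (0 : ℝ) < N := lt_trans (by positivity) hN
  refine ⟨‖c‖ + N, ?_⟩
  rintro ⟨n, X⟩
  obtain ⟨k, rfl⟩ : ∃ k, n = k + 1 := ⟨n - 1, by have := X.2.1; omega⟩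
  have hle : ∀ j : ℕ, j ≤ N → ‖((j : ℂ) / (N : ℂ))‖ ≤ 1 := by
    intro j hj
    rw [norm_div, Complex.norm_natCast, Complex.norm_natCast, div_le_one hNpos]
    exact_mod_cast hj
  have key : ∀ (j : ℕ) (hj : j ≤ N), ‖f ⟨k + 1, scale _ (hle j hj) X⟩‖ ≤ ‖c‖ + j := by
    intro j
    induction j with
    | zero =>
      intro hj
      have h1 : scale _ (hle 0 hj) X = zeroPt Λ k := by
        apply Subtype.ext
        simp [scale, zeroPt]
      rw [h1, hc, norm_smul]
      simp
    | succ j ih =>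
      intro hj
      have h1 := ih (by omega)
      have h2 := h (k + 1) (scale _ (hle (j + 1) hj) X) (scale _ (hle j (by omega)) X) (by
        have h3 : (scale _ (hle (j + 1) hj) X).1 - (scale _ (hle j (by omega)) X).1 =
            ((1 : ℂ) / N) • X.1 := by
          simp only [scale, ← sub_smul]
          congr 1
          push_cast
          ring
        rw [h3, rowNorm_smul]
        calc ENNReal.ofReal ‖(1 : ℂ) / N‖ * rowNorm X.1 ≤ ENNReal.ofReal ‖(1 : ℂ) / N‖ * 1 := by
              gcongr
              exact X.2.2.le
          _ < ENNReal.ofReal δ := by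
              rw [mul_one, ENNReal.ofReal_lt_ofReal_iff hδ, norm_div, norm_one,
                Complex.norm_natCast, div_lt_iff₀ hNpos]
              rwa [div_lt_iff₀' hδ] at hN)
      have h4 := norm_le_norm_add_norm_sub' (f ⟨k + 1, scale _ (hle (j + 1) hj) X⟩)
        (f ⟨k + 1, scale _ (hle j (by omega)) X⟩)
      push_cast
      linarith
  have h5 := key N le_rfl
  have h6 : scale _ (hle N le_rfl) X = X := by
    apply Subtype.ext
    have : (N : ℂ) ≠ 0 := by exact_mod_cast hNpos.ne'
    simp [scale, div_self this]
  rwa [h6] at h5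

/-- The algebra `A_d` (`d = |Λ|`) of all uniformly continuous noncommutative functions on the
noncommutative open unit ball. -/
def discAlgebra (Λ : Type u) : Subalgebra ℂ (GradedFun Λ) where
  carrier := {f | IsNC f ∧ IsUnifCont f}
  mul_mem' := by
    rintro f g ⟨hf, hfu⟩ ⟨hg, hgu⟩
    refine ⟨⟨fun m n X Y Z hZ => ?_, fun n S X Y hY => ?_⟩, ?_⟩
    · simp only [Pi.mul_apply, hf.map_dirSum m n X Y Z hZ, hg.map_dirSum m n X Y Z hZ, dirSum_mul]
    · simp only [Pi.mul_apply, hf.map_similar n S X Y hY, hg.map_similar n S X Y hY]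
      simp [mul_assoc]
    · obtain ⟨C, hC⟩ := exists_bound hf hfu
      obtain ⟨D, hD⟩ := exists_bound hg hgu
      intro ε hε
      obtain ⟨δ₁, hδ₁, h₁⟩ := hfu (ε / (2 * (|D| + 1))) (by positivity)
      obtain ⟨δ₂, hδ₂, h₂⟩ := hgu (ε / (2 * (|C| + 1))) (by positivity)
      refine ⟨min δ₁ δ₂, lt_min hδ₁ hδ₂, fun n X Y hXY => ?_⟩
      have e₁ := h₁ n X Y (hXY.trans_le (ENNReal.ofReal_le_ofReal (min_le_left _ _)))
      have e₂ := h₂ n X Y (hXY.trans_le (ENNReal.ofReal_le_ofReal (min_le_right _ _)))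
      rw [lt_div_iff₀ (by positivity)] at e₁ e₂
      have hCX : ‖f ⟨n, X⟩‖ ≤ |C| := (hC _).trans (le_abs_self _)
      have hDY : ‖g ⟨n, Y⟩‖ ≤ |D| := (hD _).trans (le_abs_self _)
      have hsplit : (f * g) ⟨n, X⟩ - (f * g) ⟨n, Y⟩ =
          f ⟨n, X⟩ * (g ⟨n, X⟩ - g ⟨n, Y⟩) + (f ⟨n, X⟩ - f ⟨n, Y⟩) * g ⟨n, Y⟩ := by
        simp only [Pi.mul_apply]
        noncomm_ring
      rw [hsplit]
      have n₁ := norm_mul_le (f ⟨n, X⟩) (g ⟨n, X⟩ - g ⟨n, Y⟩)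
      have n₂ := norm_mul_le (f ⟨n, X⟩ - f ⟨n, Y⟩) (g ⟨n, Y⟩)
      have n₃ := norm_add_le (f ⟨n, X⟩ * (g ⟨n, X⟩ - g ⟨n, Y⟩))
        ((f ⟨n, X⟩ - f ⟨n, Y⟩) * g ⟨n, Y⟩)
      have p₁ := mul_le_mul_of_nonneg_right hCX (norm_nonneg (g ⟨n, X⟩ - g ⟨n, Y⟩))
      have p₂ := mul_le_mul_of_nonneg_left hDY (norm_nonneg (f ⟨n, X⟩ - f ⟨n, Y⟩))
      have q₁ := norm_nonneg (g ⟨n, X⟩ - g ⟨n, Y⟩)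
      have q₂ := norm_nonneg (f ⟨n, X⟩ - f ⟨n, Y⟩)
      nlinarith
  add_mem' := by
    rintro f g ⟨hf, hfu⟩ ⟨hg, hgu⟩
    refine ⟨⟨fun m n X Y Z hZ => ?_, fun n S X Y hY => ?_⟩, ?_⟩
    · simp only [Pi.add_apply, hf.map_dirSum m n X Y Z hZ, hg.map_dirSum m n X Y Z hZ, dirSum_add]
    · simp only [Pi.add_apply, hf.map_similar n S X Y hY, hg.map_similar n S X Y hY, mul_add,
        add_mul]
    · intro ε hε
      obtain ⟨δ₁, hδ₁, h₁⟩ := hfu (ε / 2) (by positivity)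
      obtain ⟨δ₂, hδ₂, h₂⟩ := hgu (ε / 2) (by positivity)
      refine ⟨min δ₁ δ₂, lt_min hδ₁ hδ₂, fun n X Y hXY => ?_⟩
      have e₁ := h₁ n X Y (hXY.trans_le (ENNReal.ofReal_le_ofReal (min_le_left _ _)))
      have e₂ := h₂ n X Y (hXY.trans_le (ENNReal.ofReal_le_ofReal (min_le_right _ _)))
      have hsplit : (f + g) ⟨n, X⟩ - (f + g) ⟨n, Y⟩ =
          (f ⟨n, X⟩ - f ⟨n, Y⟩) + (g ⟨n, X⟩ - g ⟨n, Y⟩) := by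
        simp only [Pi.add_apply]
        abel
      rw [hsplit]
      have := norm_add_le (f ⟨n, X⟩ - f ⟨n, Y⟩) (g ⟨n, X⟩ - g ⟨n, Y⟩)
      linarith
  algebraMap_mem' := by
    intro c
    refine ⟨⟨fun m n X Y Z hZ => ?_, fun n S X Y hY => ?_⟩, fun ε hε => ⟨1, one_pos, ?_⟩⟩
    · simp only [Pi.algebraMap_apply, Algebra.algebraMap_eq_smul_one]
      exact (dirSum_smul_one c).symm
    · simp only [Pi.algebraMap_apply, Algebra.algebraMap_eq_smul_one]
      simp
    · intro n X Y _
      simpa [Pi.algebraMap_apply, Algebra.algebraMap_eq_smul_one] using hε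

/-- The coordinate functions `z i : T ↦ T i`. -/
def coord {Λ : Type u} (i : Λ) : discAlgebra Λ :=
  ⟨fun X => X.2.1 i, ⟨fun _ _ _ _ _ hZ => hZ i, fun _ _ _ _ hY => hY i⟩,
    fun ε hε => ⟨ε, hε, fun _ _ _ hXY => norm_le_of_rowNorm_lt hXY i⟩⟩

/-- The monomial `z^α = z_{α₁} ⋯ z_{αₖ}` of a word `α = α₁ … αₖ` in the alphabet `Λ`
(the empty word gives `1`). -/
def monomial {Λ : Type u} (α : List Λ) : discAlgebra Λ := (α.map coord).prod

/-- The homogeneous polynomials of degree `k` in the variables `z i`, `i ∈ Λ'`. -/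
def homogPoly {Λ : Type u} (Λ' : Finset Λ) (k : ℕ) : Submodule ℂ (discAlgebra Λ) :=
  Submodule.span ℂ {p | ∃ α : List Λ, α.length = k ∧ (∀ i ∈ α, i ∈ Λ') ∧ p = monomial α}

/-- The supremum norm over the noncommutative open unit ball. -/
def supNorm {Λ : Type u} (f : discAlgebra Λ) : ℝ≥0∞ := ⨆ X : Ball Λ, ENNReal.ofReal ‖f.1 X‖

/-- The closure of a subset of `A_d` in the supremum norm. -/
def normClosure {Λ : Type u} (E : Set (discAlgebra Λ)) : Set (discAlgebra Λ) :=
  {f | ∀ ε : ℝ≥0∞, 0 < ε → ∃ g ∈ E, supNorm (f - g) < ε}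

/-- Closedness of a two-sided ideal in the supremum norm. -/
def IsClosedIdeal {Λ : Type u} (J : TwoSidedIdeal (discAlgebra Λ)) : Prop :=
  normClosure (J : Set (discAlgebra Λ)) = (J : Set (discAlgebra Λ))

/-- The `k`-homogeneous component
`f_k(X) = (1/2π) ∫_0^{2π} f(e^{iθ} X) e^{-ikθ} dθ`, the integral being taken entrywise. -/
def homogComponent {Λ : Type u} (k : ℕ) (f : discAlgebra Λ) : GradedFun Λ := fun X =>
  Matrix.of fun a b => (1 / (2 * Real.pi) : ℂ) * ∫ θ in (0 : ℝ)..(2 * Real.pi),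
    f.1 ⟨X.1, scale (Complex.exp (θ * Complex.I)) (Complex.norm_exp_ofReal_mul_I θ).le X.2⟩ a b *
      Complex.exp (-(k * θ * Complex.I))

/-- An ideal is homogeneous if it contains the homogeneous components of its elements. -/
def IsHomogeneousIdeal {Λ : Type u} (J : TwoSidedIdeal (discAlgebra Λ)) : Prop :=
  ∀ f ∈ J, ∀ k : ℕ, ∃ g ∈ J, (g : GradedFun Λ) = homogComponent k f

/-- `J` is generated by `E` as a closed two-sided ideal. -/
def IsGeneratedBy {Λ : Type u} (J : TwoSidedIdeal (discAlgebra Λ)) (E : Set (discAlgebra Λ)) :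
    Prop :=
  (J : Set (discAlgebra Λ)) = normClosure (TwoSidedIdeal.span E : Set (discAlgebra Λ))

/-- The joint zero locus in the noncommutative open unit ball. -/
def zeroLocus {Λ : Type u} (E : Set (discAlgebra Λ)) : Set (Ball Λ) :=
  {X | ∀ f ∈ E, f.1 X = 0}

/-- The functions in `A_d` that vanish on `Ω`. -/
def vanishing {Λ : Type u} (Ω : Set (Ball Λ)) : Set (discAlgebra Λ) :=
  {f | ∀ X ∈ Ω, f.1 X = 0}

end NCBall

end

open scoped Matrix ENNReal Matrix.Norms.L2Operator

noncomputable section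

namespace NCBall

universe u v

/-! ### Square norms of vectors and matrix norms -/

/-! Only the inclusion of I(V(J)) in J has content. For f in I(V(J)) and a large finite set F of
letters, the homogeneous Taylor polynomials of f in the letters of F lie in J, and f is a uniform
limit of linear combinations of such polynomials; closedness of J then finishes
(`vanishing_zeroLocus_subset`).

Membership (`exists_taylor_mem_sup`, `taylor_mem`). On polynomials of degree at most k in the
letters of F, a space with finitely many words as basis, left multiplication by z_i is a truncated
shift. Divide by the polynomials that lie in J modulo degree > k. The shifts descend to the quotient
because J is a left ideal, and the generators act as zero there because J is a right ideal. Scaled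
into the ball and extended by zero outside F, this tuple is a point of V(J). It is jointly
nilpotent, so f acts on it by a rescaled Taylor polynomial (`evalAt_eq_sum`); applying f = 0 to the
class of the empty word puts that polynomial in J modulo degree > k, and homogeneity of J extracts
its component of degree k. The assumption on generators ensures that each one is either homogeneous
in the letters of F, or a monomial with a letter outside F, which the zero entries kill.

Approximation (`exists_norm_sub_taylor_le`, `exists_taylor_approx`). The vector (1, r, …, r^m) is an
eigenvector, with eigenvalue r, of the cyclic shift with one weight r^(m+1) and all others 1.
Tensoring X with this shift therefore gives a tuple that contains rX as a restriction to an
invariant subspace. Deleting the small weight changes f little, by uniform continuity, and leaves a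
nilpotent tuple when X has finitely many nonzero entries; there f is a polynomial. For infinite Λ,
the coefficients of each degree are square summable, so one finite set of letters serves the whole
ball. -/

/-- The square of the Euclidean norm of a vector. -/
def nsq {ι : Type*} [Fintype ι] (v : ι → ℂ) : ℝ := ∑ i, ‖v i‖ ^ 2

section nsq

variable {ι κ : Type*} [Fintype ι] [Fintype κ]

lemma nsq_nonneg (v : ι → ℂ) : 0 ≤ nsq v := Finset.sum_nonneg fun _ _ => by positivity

lemma nsq_eq_norm_sq (v : ι → ℂ) : nsq v = ‖WithLp.toLp 2 v‖ ^ 2 := by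
  rw [EuclideanSpace.norm_sq_eq]; rfl

lemma nsq_comp_equiv (e : ι ≃ κ) (v : κ → ℂ) : nsq (v ∘ e) = nsq v :=
  e.sum_comp fun i => ‖v i‖ ^ 2

lemma nsq_smul (c : ℂ) (v : ι → ℂ) : nsq (c • v) = ‖c‖ ^ 2 * nsq v := by
  simp [nsq, Finset.mul_sum, mul_pow]

lemma nsq_single [DecidableEq ι] (i : ι) (c : ℂ) : nsq (Pi.single i c) = ‖c‖ ^ 2 := by
  unfold nsq
  rw [Finset.sum_eq_single i]
  · simp
  · intro j _ hj; simp [hj]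
  · simp

lemma nsq_mulVec_le [DecidableEq ι] (A : Matrix κ ι ℂ) (v : ι → ℂ) :
    nsq (A *ᵥ v) ≤ ‖A‖ ^ 2 * nsq v := by
  rw [nsq_eq_norm_sq, nsq_eq_norm_sq, ← mul_pow]
  have := A.l2_opNorm_mulVec (WithLp.toLp 2 v)
  exact pow_le_pow_left₀ (norm_nonneg _) this 2

lemma norm_le_of_nsq_le [DecidableEq ι] {A : Matrix κ ι ℂ} {C : ℝ} (hC : 0 ≤ C)
    (h : ∀ v, nsq (A *ᵥ v) ≤ C ^ 2 * nsq v) : ‖A‖ ≤ C := by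
  rw [Matrix.l2_opNorm_def]
  refine ContinuousLinearMap.opNorm_le_bound _ hC fun v => ?_
  have h1 := h (WithLp.ofLp v)
  rw [nsq_eq_norm_sq, nsq_eq_norm_sq, ← mul_pow] at h1
  exact (abs_le_of_sq_le_sq' h1 (by positivity)).2

lemma nsq_sum_smul_le {σ : Type*} (s : Finset σ) (a : σ → ℂ) (v : σ → ι → ℂ) :
    nsq (∑ w ∈ s, a w • v w) ≤ (∑ w ∈ s, ‖a w‖ ^ 2) * ∑ w ∈ s, nsq (v w) := by
  unfold nsq
  rw [Finset.sum_comm, Finset.mul_sum]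
  refine Finset.sum_le_sum fun i _ => ?_
  simp only [Finset.sum_apply, Pi.smul_apply, smul_eq_mul]
  calc ‖∑ w ∈ s, a w * v w i‖ ^ 2 ≤ (∑ w ∈ s, ‖a w‖ * ‖v w i‖) ^ 2 := by
        gcongr
        exact (norm_sum_le _ _).trans (Finset.sum_le_sum fun w _ => norm_mul_le _ _)
    _ ≤ _ := Finset.sum_mul_sq_le_sq_mul_sq _ _ _

end nsq

/-! ### Row bounds -/

/-- The row operator of the tuple `T` has norm at most `|c|`, expressed through its adjoint. -/
def RowBound {Λ ι : Type*} [Fintype ι] (c : ℝ) (T : Λ → Matrix ι ι ℂ) : Prop :=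
  ∀ (s : Finset Λ) (v : ι → ℂ), ∑ i ∈ s, nsq ((T i)ᴴ *ᵥ v) ≤ c ^ 2 * nsq v

section RowBound

variable {Λ ι κ : Type*} [Fintype ι] [Fintype κ]

/-- The adjoints stacked into a single column R satisfy RᴴR = ∑ T_i T_iᴴ, so the C*-identity turns
the square root into ‖R‖. -/
lemma norm_sum_mul_conjTranspose [DecidableEq ι] (T : Λ → Matrix ι ι ℂ) (s : Finset Λ) {c : ℝ}
    (hc : 0 ≤ c) :
    Real.sqrt ‖∑ i ∈ s, T i * (T i)ᴴ‖ ≤ c ↔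
      ∀ v : ι → ℂ, ∑ i ∈ s, nsq ((T i)ᴴ *ᵥ v) ≤ c ^ 2 * nsq v := by
  classical
  let R : Matrix (s × ι) ι ℂ := Matrix.of fun p a => (T p.1)ᴴ p.2 a
  have hR : Rᴴ * R = ∑ i ∈ s, T i * (T i)ᴴ := by
    ext a b
    rw [Matrix.mul_apply, Fintype.sum_prod_type, Matrix.sum_apply, ← Finset.sum_coe_sort s]
    refine Finset.sum_congr rfl fun i _ => ?_
    simp [R, Matrix.mul_apply]
  have hn (v : ι → ℂ) : nsq (R *ᵥ v) = ∑ i ∈ s, nsq ((T i)ᴴ *ᵥ v) := by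
    unfold nsq
    rw [Fintype.sum_prod_type, ← Finset.sum_coe_sort s]
    rfl
  rw [← hR, Matrix.l2_opNorm_conjTranspose_mul_self, Real.sqrt_mul_self (norm_nonneg _)]
  simp only [← hn]
  refine ⟨fun h v => (nsq_mulVec_le R v).trans ?_, norm_le_of_nsq_le hc⟩
  have := nsq_nonneg v
  gcongr

lemma rowNorm_le_iff {n : ℕ} (T : Tuple Λ n) {c : ℝ} (hc : 0 ≤ c) :
    rowNorm T ≤ ENNReal.ofReal c ↔ RowBound c T := by
  unfold rowNorm
  rw [iSup_le_iff]
  refine forall_congr' fun s => ?_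
  rw [ENNReal.ofReal_le_ofReal_iff hc, norm_sum_mul_conjTranspose _ _ hc]

lemma exists_rowBound_of_rowNorm_lt {n : ℕ} {T : Tuple Λ n} {d : ℝ}
    (h : rowNorm T < ENNReal.ofReal d) : ∃ c, 0 ≤ c ∧ c < d ∧ RowBound c T := by
  have ht : rowNorm T ≠ ⊤ := h.ne_top
  have he : ENNReal.ofReal (rowNorm T).toReal = rowNorm T := ENNReal.ofReal_toReal ht
  refine ⟨(rowNorm T).toReal, ENNReal.toReal_nonneg, ?_, ?_⟩
  · rw [← he] at h
    exact (ENNReal.ofReal_lt_ofReal_iff_of_nonneg ENNReal.toReal_nonneg).1 h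
  · rw [← rowNorm_le_iff _ ENNReal.toReal_nonneg, he]

lemma rowNorm_lt_of_rowBound {n : ℕ} {T : Tuple Λ n} {c d : ℝ} (hc : 0 ≤ c) (hcd : c < d)
    (h : RowBound c T) : rowNorm T < ENNReal.ofReal d :=
  ((rowNorm_le_iff T hc).2 h).trans_lt ((ENNReal.ofReal_lt_ofReal_iff (hc.trans_lt hcd)).2 hcd)

lemma RowBound.mono {T : Λ → Matrix ι ι ℂ} {c d : ℝ} (hc : 0 ≤ c) (hcd : c ≤ d)
    (h : RowBound c T) : RowBound d T := fun s v => (h s v).trans (by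
  have := nsq_nonneg v
  gcongr)

lemma RowBound.smul {T : Λ → Matrix ι ι ℂ} {c : ℝ} (h : RowBound c T) (a : ℂ) :
    RowBound (‖a‖ * c) (a • T) := fun s v => by
  have h1 (i : Λ) : nsq (((a • T) i)ᴴ *ᵥ v) = ‖a‖ ^ 2 * nsq ((T i)ᴴ *ᵥ v) := by
    rw [Pi.smul_apply, Matrix.conjTranspose_smul, Matrix.smul_mulVec, nsq_smul, norm_star]
  simp only [h1, ← Finset.mul_sum]
  calc _ ≤ ‖a‖ ^ 2 * (c ^ 2 * nsq v) := by gcongr; exact h s v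
    _ = _ := by ring

lemma mulVec_submatrix_equiv (A : Matrix ι ι ℂ) (e : κ ≃ ι) (v : κ → ℂ) :
    A.submatrix e e *ᵥ v = (A *ᵥ (v ∘ e.symm)) ∘ e := by
  ext a
  simp only [Matrix.mulVec, dotProduct, Function.comp, Matrix.submatrix_apply]
  rw [← e.sum_comp]
  simp

lemma RowBound.submatrix {T : Λ → Matrix ι ι ℂ} {c : ℝ} (h : RowBound c T) (e : κ ≃ ι) :
    RowBound c (fun i => (T i).submatrix e e) := fun s v => by
  simp only [Matrix.conjTranspose_submatrix, mulVec_submatrix_equiv, nsq_comp_equiv]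
  simpa only [nsq_comp_equiv] using h s (v ∘ e.symm)

/-- A tuple with finitely many nonzero entries is bounded. -/
lemma exists_rowBound_of_finite [DecidableEq ι] (T : Λ → Matrix ι ι ℂ) (F : Finset Λ)
    (hF : ∀ i ∉ F, T i = 0) : ∃ c, 0 ≤ c ∧ RowBound c T := by
  classical
  refine ⟨Real.sqrt (∑ i ∈ F, ‖(T i)ᴴ‖ ^ 2), Real.sqrt_nonneg _, fun s v => ?_⟩
  rw [Real.sq_sqrt (Finset.sum_nonneg fun _ _ => by positivity), Finset.sum_mul]
  calc ∑ i ∈ s, nsq ((T i)ᴴ *ᵥ v) ≤ ∑ i ∈ s ∪ F, nsq ((T i)ᴴ *ᵥ v) :=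
        Finset.sum_le_sum_of_subset_of_nonneg Finset.subset_union_left fun _ _ _ => nsq_nonneg _
    _ = ∑ i ∈ F, nsq ((T i)ᴴ *ᵥ v) := by
        refine (Finset.sum_subset Finset.subset_union_right fun i _ hi => ?_).symm
        rw [hF i hi]; simp [nsq]
    _ ≤ _ := Finset.sum_le_sum fun i _ => nsq_mulVec_le _ _

end RowBound

/-! ### Evaluation at tuples of matrices over an arbitrary finite index type -/

section evalAt

variable {Λ : Type u} {ι κ : Type*} [Fintype ι] [Fintype κ]

/-- Strict row contractions over an arbitrary nonempty finite index type. -/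
def InBall (X : Λ → Matrix ι ι ℂ) : Prop := Nonempty ι ∧ ∃ c, 0 ≤ c ∧ c < 1 ∧ RowBound c X

lemma mem_ballLevel_iff {n : ℕ} {X : Tuple Λ n} : X ∈ ballLevel Λ n ↔ InBall X := by
  unfold ballLevel InBall
  rw [Set.mem_ofPred_eq, ← Fin.pos_iff_nonempty, ← ENNReal.ofReal_one]
  refine and_congr_right fun _ => ⟨exists_rowBound_of_rowNorm_lt, ?_⟩
  rintro ⟨c, h0, h1, h⟩
  exact rowNorm_lt_of_rowBound h0 h1 h

lemma InBall.submatrix {X : Λ → Matrix ι ι ℂ} (h : InBall X) (e : κ ≃ ι) :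
    InBall (fun i => (X i).submatrix e e) := by
  obtain ⟨hn, c, h0, h1, h⟩ := h
  exact ⟨⟨e.symm hn.some⟩, c, h0, h1, h.submatrix e⟩

lemma dirSum_mulVec_nsq {m n : ℕ} (A : Matrix (Fin m) (Fin m) ℂ) (B : Matrix (Fin n) (Fin n) ℂ)
    (v : Fin (m + n) → ℂ) :
    nsq ((dirSum A B)ᴴ *ᵥ v) =
      nsq (Aᴴ *ᵥ (v ∘ Fin.castAdd n)) + nsq (Bᴴ *ᵥ (v ∘ Fin.natAdd m)) := by
  unfold dirSum nsq
  rw [Matrix.reindex_apply, Matrix.conjTranspose_submatrix, mulVec_submatrix_equiv,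
    Fin.sum_univ_add, Matrix.fromBlocks_conjTranspose, Matrix.fromBlocks_mulVec]
  simp [Function.comp_def]

lemma rowBound_dirSum {m n : ℕ} {X : Tuple Λ m} {Y : Tuple Λ n} {c : ℝ} (hX : RowBound c X)
    (hY : RowBound c Y) : RowBound c (fun i => dirSum (X i) (Y i)) := fun s v => by
  simp only [dirSum_mulVec_nsq, Finset.sum_add_distrib]
  have hv : nsq v = nsq (v ∘ Fin.castAdd n) + nsq (v ∘ Fin.natAdd m) := by
    simp [nsq, Fin.sum_univ_add]
  rw [hv, mul_add]
  exact add_le_add (hX s _) (hY s _)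

/-- Noncommutative functions respect intertwiners. -/
lemma IsNC.map_intertwine {f : GradedFun Λ} (hf : IsNC f) {m n : ℕ} (X : ballLevel Λ m)
    (Y : ballLevel Λ n) (T : Matrix (Fin n) (Fin m) ℂ) (h : ∀ i, T * X.1 i = Y.1 i * T) :
    T * f ⟨m, X⟩ = f ⟨n, Y⟩ * T := by
  obtain ⟨⟨a⟩, c, hc0, hc1, hc⟩ := mem_ballLevel_iff.1 X.2
  obtain ⟨_, d, hd0, hd1, hd⟩ := mem_ballLevel_iff.1 Y.2
  have hZ : (fun i => dirSum (X.1 i) (Y.1 i)) ∈ ballLevel Λ (m + n) :=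
    mem_ballLevel_iff.2 ⟨⟨Fin.castAdd n a⟩, max c d, le_max_of_le_left hc0, max_lt hc1 hd1,
      rowBound_dirSum (hc.mono hc0 (le_max_left _ _)) (hd.mono hd0 (le_max_right _ _))⟩
  let φ := Matrix.reindexAlgEquiv ℂ ℂ (finSumFinEquiv (m := m) (n := n))
  have hφ (A : Matrix (Fin m) (Fin m) ℂ) (B : Matrix (Fin n) (Fin n) ℂ) :
      dirSum A B = φ (Matrix.fromBlocks A 0 0 B) := rfl
  -- A unipotent block matrix with T in the corner commutes with A ⊕ B exactly when TA = BT. So X ⊕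
  -- Y is similar to itself via S, and f(X) ⊕ f(Y) must commute with S as well.
  let S : (Matrix (Fin (m + n)) (Fin (m + n)) ℂ)ˣ :=
    ⟨φ (Matrix.fromBlocks 1 0 T 1), φ (Matrix.fromBlocks 1 0 (-T) 1), by
      rw [← map_mul]; simp [Matrix.fromBlocks_multiply], by
      rw [← map_mul]; simp [Matrix.fromBlocks_multiply]⟩
  have hcomm (A : Matrix (Fin m) (Fin m) ℂ) (B : Matrix (Fin n) (Fin n) ℂ) :
      dirSum A B * (S : Matrix (Fin (m + n)) (Fin (m + n)) ℂ) = S * dirSum A B ↔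
        T * A = B * T := by
    change φ _ * φ _ = φ _ * φ _ ↔ _
    rw [← map_mul, ← map_mul, φ.injective.eq_iff, Matrix.fromBlocks_multiply,
      Matrix.fromBlocks_multiply, Matrix.fromBlocks_inj]
    simp [eq_comm]
  have h1 := hf.map_similar (m + n) S ⟨_, hZ⟩ ⟨_, hZ⟩ (fun i => by
    rw [mul_assoc, (hcomm _ _).2 (h i), ← mul_assoc, Units.inv_mul, one_mul])
  have h2 := hf.map_dirSum m n X Y ⟨_, hZ⟩ fun i => rfl
  rw [h2] at h1
  refine (hcomm _ _).1 ?_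
  conv_rhs => rw [h1]
  rw [mul_assoc, ← mul_assoc, Units.mul_inv, one_mul]

open Classical in
/-- The value of a function in `A_d` at a strict row contraction over an arbitrary finite index
type (and `0` at other tuples). -/
def evalAt (f : discAlgebra Λ) (X : Λ → Matrix ι ι ℂ) : Matrix ι ι ℂ :=
  if h : InBall X then
    (f.1 ⟨Fintype.card ι, fun i => (X i).submatrix (Fintype.equivFin ι).symm
      (Fintype.equivFin ι).symm, mem_ballLevel_iff.2 (h.submatrix _)⟩).submatrix
        (Fintype.equivFin ι) (Fintype.equivFin ι)
  else 0

/-- This is what allows spans of words and tensor products to serve directly as index types; the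
enumerations hidden in `evalAt` are absorbed into the intertwiner. -/
lemma evalAt_intertwine (f : discAlgebra Λ) {X : Λ → Matrix ι ι ℂ} {Y : Λ → Matrix κ κ ℂ}
    (hX : InBall X) (hY : InBall Y) (T : Matrix κ ι ℂ) (h : ∀ i, T * X i = Y i * T) :
    T * evalAt f X = evalAt f Y * T := by
  have h1 := f.2.1.map_intertwine ⟨_, mem_ballLevel_iff.2 (hX.submatrix (Fintype.equivFin ι).symm)⟩
    ⟨_, mem_ballLevel_iff.2 (hY.submatrix (Fintype.equivFin κ).symm)⟩
    (T.submatrix (Fintype.equivFin κ).symm (Fintype.equivFin ι).symm) (fun i => by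
      simp only [Matrix.submatrix_mul_equiv, h i])
  have h2 := congrArg (fun M => M.submatrix (Fintype.equivFin κ) (Fintype.equivFin ι)) h1
  simp only [← Matrix.submatrix_mul_equiv _ _ _ (Fintype.equivFin ι),
    Matrix.submatrix_submatrix, Equiv.symm_comp_self, Matrix.submatrix_id_id] at h2
  rw [evalAt, evalAt, dif_pos hX, dif_pos hY]
  rw [h2, ← Matrix.submatrix_mul_equiv _ _ _ (Fintype.equivFin κ), Matrix.submatrix_submatrix]
  simp

/-- The enumeration chosen in `evalAt` need not be the identity, but its permutation matrix is an
intertwiner, so the choice does not matter. -/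
lemma evalAt_fin (f : discAlgebra Λ) {n : ℕ} (X : ballLevel Λ n) : evalAt f X.1 = f.1 ⟨n, X⟩ := by
  have hX := mem_ballLevel_iff.1 X.2
  let e := Fintype.equivFin (Fin n)
  rw [evalAt, dif_pos hX]
  have h1 := f.2.1.map_intertwine X ⟨_, mem_ballLevel_iff.2 (hX.submatrix e.symm)⟩
    ((1 : Matrix (Fin n) (Fin n) ℂ).submatrix e.symm id) (fun i => by
      ext a b
      simp [Matrix.mul_apply, Matrix.one_apply, ← e.sum_comp])
  ext a b
  have h2 := congrFun (congrFun h1 (e a)) b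
  simp only [Matrix.mul_apply, Matrix.submatrix_apply, ← e.sum_comp, Matrix.one_apply] at h2
  simp at h2
  simpa [e] using h2.symm

lemma norm_sub_le_evalAt (f : discAlgebra Λ) {ε : ℝ} (hε : 0 < ε) :
    ∃ δ : ℝ, 0 < δ ∧ ∀ {ι : Type v} [Fintype ι] (X Y : Λ → Matrix ι ι ℂ), InBall X → InBall Y →
      ∀ c, 0 ≤ c → c < δ → RowBound c (X - Y) →
        ∀ v, nsq ((evalAt f X - evalAt f Y) *ᵥ v) ≤ ε ^ 2 * nsq v := by
  obtain ⟨δ, hδ, h⟩ := f.2.2 ε hε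
  refine ⟨δ, hδ, fun {ι} _ X Y hX hY c hc0 hc hXY v => ?_⟩
  have h1 := h _ ⟨_, mem_ballLevel_iff.2 (hX.submatrix (Fintype.equivFin ι).symm)⟩
    ⟨_, mem_ballLevel_iff.2 (hY.submatrix (Fintype.equivFin ι).symm)⟩
    (rowNorm_lt_of_rowBound hc0 hc (hXY.submatrix _))
  rw [evalAt, evalAt, dif_pos hX, dif_pos hY]
  have hs (A B : Matrix (Fin (Fintype.card ι)) (Fin (Fintype.card ι)) ℂ) (e : ι ≃ Fin _) :
      A.submatrix e e - B.submatrix e e = (A - B).submatrix e e := rfl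
  rw [hs, mulVec_submatrix_equiv, nsq_comp_equiv, ← nsq_comp_equiv (Fintype.equivFin ι).symm v]
  refine (nsq_mulVec_le _ _).trans ?_
  have := nsq_nonneg (v ∘ (Fintype.equivFin ι).symm)
  gcongr

lemma exists_evalAt_bound (f : discAlgebra Λ) :
    ∃ C : ℝ, 0 ≤ C ∧ ∀ {ι : Type v} [Fintype ι] (X : Λ → Matrix ι ι ℂ) (v : ι → ℂ),
      nsq (evalAt f X *ᵥ v) ≤ C ^ 2 * nsq v := by
  obtain ⟨C, hC⟩ := exists_bound f.2.1 f.2.2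
  refine ⟨max C 0, le_max_right _ _, fun {ι} _ X v => ?_⟩
  have h0 := nsq_nonneg v
  by_cases hX : InBall X
  · rw [evalAt, dif_pos hX, mulVec_submatrix_equiv, nsq_comp_equiv]
    refine (nsq_mulVec_le _ _).trans ?_
    rw [nsq_comp_equiv]
    gcongr
    exact (hC _).trans (le_max_left _ _)
  · rw [evalAt, dif_neg hX, Matrix.zero_mulVec]
    simpa [nsq] using by positivity

end evalAt

/-! ### Words and evaluation of monomials -/

section words

variable {Λ : Type u}

/-- The product of matrices along a word. -/
def wordProd {κ : Type*} [Fintype κ] [DecidableEq κ] (Y : Λ → Matrix κ κ ℂ) (w : List Λ) :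
    Matrix κ κ ℂ := (w.map Y).prod

lemma wordProd_nil {κ : Type*} [Fintype κ] [DecidableEq κ] (Y : Λ → Matrix κ κ ℂ) :
    wordProd Y [] = 1 := rfl

lemma wordProd_cons {κ : Type*} [Fintype κ] [DecidableEq κ] (Y : Λ → Matrix κ κ ℂ) (i : Λ)
    (w : List Λ) : wordProd Y (i :: w) = Y i * wordProd Y w := by simp [wordProd]

lemma wordProd_smul {κ : Type*} [Fintype κ] [DecidableEq κ] (Y : Λ → Matrix κ κ ℂ) (c : ℂ)
    (w : List Λ) : wordProd (c • Y) w = c ^ w.length • wordProd Y w := by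
  induction w with
  | nil => simp [wordProd_nil]
  | cons i w ih =>
    rw [wordProd_cons, wordProd_cons, ih]
    simp [smul_smul, pow_succ, mul_comm]

lemma wordProd_eq_zero {κ : Type*} [Fintype κ] [DecidableEq κ] {Y : Λ → Matrix κ κ ℂ} {i : Λ}
    (hi : Y i = 0) {w : List Λ} (hw : i ∈ w) : wordProd Y w = 0 :=
  List.prod_eq_zero (List.mem_map.2 ⟨i, hw, hi⟩)

lemma monomial_apply (w : List Λ) (X : Ball Λ) : (monomial w).1 X = wordProd X.2.1 w := by
  induction w with
  | nil => rfl
  | cons i w ih =>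
    rw [wordProd_cons, ← ih]
    simp [monomial, coord]

variable [DecidableEq Λ]

/-- The words of length `k` with letters in `F`. -/
def words (F : Finset Λ) : ℕ → Finset (List Λ)
  | 0 => {[]}
  | k + 1 => (F ×ˢ words F k).image fun p => p.1 :: p.2

lemma mem_words {F : Finset Λ} {k : ℕ} {w : List Λ} :
    w ∈ words F k ↔ w.length = k ∧ ∀ i ∈ w, i ∈ F := by
  induction k generalizing w with
  | zero =>
    rw [words, Finset.mem_singleton, List.length_eq_zero_iff]
    exact ⟨fun h => ⟨h, by simp [h]⟩, fun h => h.1⟩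
  | succ k ih =>
    rw [words, Finset.mem_image]
    constructor
    · rintro ⟨⟨i, w⟩, h, rfl⟩
      rw [Finset.mem_product, ih] at h
      simpa using ⟨h.2.1, h.1, h.2.2⟩
    · cases w with
      | nil => simp
      | cons i w =>
        rintro ⟨h1, h2⟩
        refine ⟨⟨i, w⟩, ?_, rfl⟩
        rw [Finset.mem_product, ih]
        simp at h1 h2
        exact ⟨h2.1, h1, h2.2⟩

lemma sum_words_succ {M : Type*} [AddCommMonoid M] (F : Finset Λ) (k : ℕ) (g : List Λ → M) :
    ∑ w ∈ words F (k + 1), g w = ∑ i ∈ F, ∑ w ∈ words F k, g (i :: w) := by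
  rw [words, Finset.sum_image, Finset.sum_product]
  rintro ⟨i, w⟩ _ ⟨j, w'⟩ _ h
  simpa using h

/-- The words of length less than `m` with letters in `F`. -/
def wordsBelow (F : Finset Λ) (m : ℕ) : Finset (List Λ) := (Finset.range m).biUnion (words F)

lemma mem_wordsBelow {F : Finset Λ} {m : ℕ} {w : List Λ} :
    w ∈ wordsBelow F m ↔ w.length < m ∧ ∀ i ∈ w, i ∈ F := by
  simp [wordsBelow, mem_words]

lemma sum_wordsBelow {M : Type*} [AddCommMonoid M] (F : Finset Λ) (m : ℕ) (g : List Λ → M) :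
    ∑ w ∈ wordsBelow F m, g w = ∑ k ∈ Finset.range m, ∑ w ∈ words F k, g w := by
  refine Finset.sum_biUnion fun k _ l _ hkl => Finset.disjoint_left.2 fun w hk hl => hkl ?_
  rw [← (mem_words.1 hk).1, ← (mem_words.1 hl).1]

/-- Sets of words that contain the empty word and are closed under removal of the first letter. -/
structure IsSuffixClosed (S : Finset (List Λ)) : Prop where
  nil_mem : [] ∈ S
  of_cons : ∀ i w, i :: w ∈ S → w ∈ S

lemma isSuffixClosed_tails (w : List Λ) : IsSuffixClosed w.tails.toFinset where
  nil_mem := by simp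
  of_cons i u h := by
    simp only [List.mem_toFinset, List.mem_tails] at h ⊢
    exact (List.suffix_cons i u).trans h

lemma isSuffixClosed_wordsBelow (F : Finset Λ) (m : ℕ) : IsSuffixClosed (wordsBelow F (m + 1)) where
  nil_mem := by simp [mem_wordsBelow]
  of_cons i u h := by
    rw [mem_wordsBelow] at h ⊢
    simp at h
    exact ⟨by omega, h.2.2⟩

/-! ### Truncated shifts and coefficients -/

/-- The truncated creation operators on the span of a finite set of words. -/
def shift (S : Finset (List Λ)) (i : Λ) : Matrix S S ℂ :=
  Matrix.of fun u w => if (u : List Λ) = i :: w then 1 else 0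

lemma shift_apply (S : Finset (List Λ)) (i : Λ) (u w : S) :
    shift S i u w = if (u : List Λ) = i :: w then 1 else 0 := rfl

lemma sum_ite_eq_coe {M : Type*} [AddCommMonoid M] (S : Finset (List Λ)) (u : List Λ)
    (g : S → M) : ∑ x : S, (if (x : List Λ) = u then g x else 0) =
      if h : u ∈ S then g ⟨u, h⟩ else 0 := by
  split_ifs with h
  · rw [Finset.sum_eq_single ⟨u, h⟩]
    · simp
    · intro x _ hx
      rw [if_neg fun e => hx (Subtype.ext e)]
    · simp
  · refine Finset.sum_eq_zero fun x _ => if_neg fun (e : (x : List Λ) = u) => h (e ▸ x.2)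

/-- The adjoint of the i-th shift reads off the coordinate at i :: w. These words are distinct for
distinct pairs (i, w), so no coordinate of v is counted twice. -/
lemma rowBound_shift (S : Finset (List Λ)) : RowBound 1 (shift S) := fun s v => by
  let g : List Λ → ℝ := fun u => if h : u ∈ S then ‖v ⟨u, h⟩‖ ^ 2 else 0
  have h1 (i : Λ) (w : S) : ‖((shift S i)ᴴ *ᵥ v) w‖ ^ 2 = g (i :: w) := by
    have : ((shift S i)ᴴ *ᵥ v) w = ∑ x : S, if (x : List Λ) = i :: w then v x else 0 := by
      simp only [Matrix.mulVec, dotProduct, Matrix.conjTranspose_apply, shift_apply]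
      refine Finset.sum_congr rfl fun x _ => ?_
      split_ifs <;> simp
    rw [this, sum_ite_eq_coe]
    simp only [g]
    split_ifs <;> simp
  have hg (u : List Λ) : 0 ≤ g u := by simp only [g]; split_ifs <;> positivity
  have h2 : nsq v = ∑ u ∈ S, g u := by
    rw [nsq, ← Finset.sum_coe_sort S]
    refine Finset.sum_congr rfl fun u _ => ?_
    simp [g]
  have h3 : ∑ i ∈ s, nsq ((shift S i)ᴴ *ᵥ v) =
      ∑ u ∈ (s ×ˢ S).image (fun p => p.1 :: p.2), g u := by
    rw [Finset.sum_image, Finset.sum_product]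
    · refine Finset.sum_congr rfl fun i _ => ?_
      rw [nsq, ← Finset.sum_coe_sort S]
      exact Finset.sum_congr rfl fun w _ => h1 i w
    · rintro ⟨i, w⟩ _ ⟨j, w'⟩ _ h
      simpa using h
  rw [h3, h2, one_pow, one_mul]
  rw [← Finset.sum_filter_of_ne (p := (· ∈ S)) fun u _ hu => ?_]
  · exact Finset.sum_le_sum_of_subset_of_nonneg (fun u hu => (Finset.mem_filter.1 hu).2)
      fun u _ _ => hg u
  · by_contra h
    exact hu (by simp [g, h])

/-- The truncated creation operators, scaled into the open unit ball. -/
def halfShift (S : Finset (List Λ)) : Λ → Matrix S S ℂ := (1 / 2 : ℂ) • shift S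

lemma halfShift_apply (S : Finset (List Λ)) (i : Λ) (u w : S) :
    halfShift S i u w = if (u : List Λ) = i :: w then 1 / 2 else 0 := by
  simp [halfShift, shift_apply]

lemma inBall_halfShift {S : Finset (List Λ)} (hS : IsSuffixClosed S) : InBall (halfShift S) := by
  refine ⟨⟨⟨[], hS.nil_mem⟩⟩, _, ?_, ?_, (rowBound_shift S).smul (1 / 2)⟩ <;> norm_num

/-- The Taylor coefficient at the word `w` of a function in `A_d`. -/
def coeff (f : discAlgebra Λ) (w : List Λ) : ℂ :=
  2 ^ w.length * evalAt f (halfShift w.tails.toFinset) ⟨w, by simp⟩ ⟨[], by simp⟩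

/-- The coordinate projection from the span of S onto that of S' intertwines the shifts: as S' is
closed under suffixes, prepending a letter to a word outside S' never leads into S'. -/
lemma evalAt_halfShift_of_subset (f : discAlgebra Λ) {S S' : Finset (List Λ)}
    (hS : IsSuffixClosed S) (hS' : IsSuffixClosed S') (hsub : S' ⊆ S) (w : List Λ) (hw : w ∈ S') :
    evalAt f (halfShift S) ⟨w, hsub hw⟩ ⟨[], hS.nil_mem⟩ =
      evalAt f (halfShift S') ⟨w, hw⟩ ⟨[], hS'.nil_mem⟩ := by
  let T : Matrix S' S ℂ := Matrix.of fun u w => if (w : List Λ) = u then 1 else 0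
  have hT : ∀ i, T * halfShift S i = halfShift S' i * T := fun i => by
    ext u x
    simp only [Matrix.mul_apply, T, Matrix.of_apply, halfShift_apply, ite_mul, one_mul, zero_mul,
      mul_ite, mul_one, mul_zero]
    rw [sum_ite_eq_coe]
    have h2 : (if h : i :: (x : List Λ) ∈ S then if i :: (x : List Λ) = u then (1 / 2 : ℂ) else 0
        else 0) = if (u : List Λ) = i :: x then 1 / 2 else 0 := by
      by_cases h : (u : List Λ) = i :: x
      · rw [dif_pos (h ▸ hsub u.2), if_pos h, if_pos h.symm]
      · simp [h, Ne.symm h]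
    refine h2.trans ?_
    have h1 (y : S') : (if (x : List Λ) = y then if (u : List Λ) = i :: y then (1 / 2 : ℂ) else 0
        else 0) = if (y : List Λ) = x then if (u : List Λ) = i :: x then (1 / 2 : ℂ) else 0
        else 0 := by
      by_cases h : (x : List Λ) = y
      · rw [if_pos h, if_pos h.symm, h]
      · rw [if_neg h, if_neg fun e => h e.symm]
    rw [Finset.sum_congr rfl fun y _ => h1 y, sum_ite_eq_coe]
    by_cases hx : (x : List Λ) ∈ S'
    · rw [dif_pos hx]
    · rw [dif_neg hx, if_neg]
      intro e
      exact hx (hS'.of_cons i x (e ▸ u.2))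
  have h1 := congrFun (congrFun (evalAt_intertwine f (inBall_halfShift hS) (inBall_halfShift hS')
    T hT) ⟨w, hw⟩) ⟨[], hS.nil_mem⟩
  simp only [Matrix.mul_apply, T, Matrix.of_apply, ite_mul, one_mul, zero_mul,
      mul_ite, mul_one, mul_zero] at h1
  rw [sum_ite_eq_coe, dif_pos (hsub hw)] at h1
  rw [h1]
  simp only [eq_comm (a := ([] : List Λ))]
  rw [sum_ite_eq_coe, dif_pos hS'.nil_mem]

lemma evalAt_halfShift (f : discAlgebra Λ) {S : Finset (List Λ)} (hS : IsSuffixClosed S)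
    (w : List Λ) (hw : w ∈ S) :
    2 ^ w.length * evalAt f (halfShift S) ⟨w, hw⟩ ⟨[], hS.nil_mem⟩ = coeff f w := by
  have hsub : w.tails.toFinset ⊆ S := fun u hu => by
    rw [List.mem_toFinset, List.mem_tails] at hu
    obtain ⟨t, rfl⟩ := hu
    induction t with
    | nil => exact hw
    | cons i t ih => exact ih (hS.of_cons i _ hw)
  rw [coeff, evalAt_halfShift_of_subset f hS (isSuffixClosed_tails w) hsub w (by simp)]

/-- On jointly nilpotent tuples a function in `A_d` is given by its Taylor polynomial. -/
lemma evalAt_eq_sum {κ : Type*} [Fintype κ] [DecidableEq κ] (f : discAlgebra Λ)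
    {S : Finset (List Λ)} (hS : IsSuffixClosed S) {Y : Λ → Matrix κ κ ℂ} (hY : InBall Y)
    (h0 : ∀ w ∈ S, ∀ i, i :: w ∉ S → wordProd Y (i :: w) = 0) :
    evalAt f Y = ∑ w ∈ S, coeff f w • wordProd Y w := by
  ext a b
  -- For a fixed column b, the basis vector of w goes to 2^|w| Y^w e_b. The power of 2 undoes the
  -- factor 1/2 in `halfShift`, and `h0` covers the words where the truncated shift leaves S. The
  -- column at the empty word then gives f(Y) e_b.
  let T : Matrix κ S ℂ := Matrix.of fun c w => 2 ^ w.1.length * wordProd Y w.1 c b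
  have hT : ∀ i, T * halfShift S i = Y i * T := fun i => by
    ext c w
    simp only [Matrix.mul_apply, T, Matrix.of_apply, halfShift_apply, mul_ite, mul_zero]
    rw [sum_ite_eq_coe]
    have h1 : ∑ x, Y i c x * (2 ^ w.1.length * wordProd Y w.1 x b) =
        2 ^ w.1.length * wordProd Y (i :: w.1) c b := by
      rw [wordProd_cons, Matrix.mul_apply, Finset.mul_sum]
      exact Finset.sum_congr rfl fun x _ => by ring
    rw [h1]
    split_ifs with h
    · rw [List.length_cons, pow_succ]; ring
    · rw [h0 _ w.2 i h]; simp
  have h1 := congrFun (congrFun (evalAt_intertwine f (inBall_halfShift hS) hY T hT) a)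
    ⟨[], hS.nil_mem⟩
  simp only [Matrix.mul_apply, T, Matrix.of_apply, wordProd_nil, Matrix.one_apply, mul_ite,
    mul_one, mul_zero, List.length_nil, pow_zero, Finset.sum_ite_eq', Finset.mem_univ,
    if_true] at h1
  rw [← h1, Matrix.sum_apply, ← Finset.sum_coe_sort S]
  refine Finset.sum_congr rfl fun w _ => ?_
  rw [Matrix.smul_apply, smul_eq_mul, ← evalAt_halfShift f hS w.1 w.2]
  ring

/-! ### Square summability of the coefficients -/

/-- The numbers coeff f w / 2^|w| form the column of f(`halfShift`) at the empty word, whose norm is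
at most the bound of f. That bound does not depend on F. -/
lemma exists_sum_coeff_le (f : discAlgebra Λ) : ∃ C : ℝ, ∀ (F : Finset Λ) (k : ℕ),
    ∑ w ∈ words F k, ‖coeff f w‖ ^ 2 ≤ 4 ^ k * C := by
  obtain ⟨C, hC, h⟩ := exists_evalAt_bound.{u, u} f
  refine ⟨C ^ 2, fun F k => ?_⟩
  have hS := isSuffixClosed_wordsBelow F k
  let g : wordsBelow F (k + 1) → ℂ := fun w =>
    evalAt f (halfShift (wordsBelow F (k + 1))) w ⟨[], hS.nil_mem⟩
  have h1 := h (halfShift (wordsBelow F (k + 1))) (Pi.single ⟨[], hS.nil_mem⟩ 1)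
  rw [nsq_single, Matrix.mulVec_single_one, norm_one, one_pow, mul_one] at h1
  have h2 : ∑ w ∈ words F k, ‖coeff f w‖ ^ 2 / 4 ^ k ≤ nsq g := by
    have h3 : nsq g = ∑ w ∈ wordsBelow F (k + 1), ‖coeff f w‖ ^ 2 / 4 ^ w.length := by
      rw [nsq, ← Finset.sum_coe_sort (wordsBelow F (k + 1))]
      refine Finset.sum_congr rfl fun w _ => ?_
      rw [← evalAt_halfShift f hS w.1 w.2, norm_mul, mul_pow, norm_pow, ← pow_mul, mul_comm _ 2,
        pow_mul]
      norm_num [g]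
    rw [h3, sum_wordsBelow, Finset.sum_range_succ]
    refine le_add_of_nonneg_of_le
      (Finset.sum_nonneg fun _ _ => Finset.sum_nonneg fun _ _ => by positivity) (le_of_eq ?_)
    exact Finset.sum_congr rfl fun w hw => by rw [(mem_words.1 hw).1]
  rw [← Finset.sum_div, div_le_iff₀ (by positivity)] at h2
  refine h2.trans ?_
  rw [mul_comm]
  gcongr
  exact h1

/-- The bound uniform in finite sets of letters makes the squares summable over all words of length
k, whatever the cardinality of Λ. G collects the letters of finitely many words carrying almost all
of the sum. -/
lemma exists_sum_coeff_lt (f : discAlgebra Λ) (k : ℕ) {η : ℝ} (hη : 0 < η) :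
    ∃ G : Finset Λ, ∀ A : Finset (List Λ),
      (∀ w ∈ A, w.length = k ∧ ¬ ∀ i ∈ w, i ∈ G) → ∑ w ∈ A, ‖coeff f w‖ ^ 2 < η := by
  obtain ⟨C, hC⟩ := exists_sum_coeff_le f
  let c : List Λ → ℝ := fun w => if w.length = k then ‖coeff f w‖ ^ 2 else 0
  have hc (w : List Λ) : 0 ≤ c w := by simp only [c]; split_ifs <;> positivity
  have hsum : Summable c := by
    refine summable_of_sum_le hc (c := 4 ^ k * C) fun A => ?_
    refine le_trans ?_ (hC (A.biUnion List.toFinset) k)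
    have h1 : ∑ w ∈ A, c w = ∑ w ∈ A.filter (fun w => w.length = k), ‖coeff f w‖ ^ 2 := by
      rw [Finset.sum_filter]
    rw [h1]
    refine Finset.sum_le_sum_of_subset_of_nonneg (fun w hw => ?_) fun _ _ _ => by positivity
    rw [Finset.mem_filter] at hw
    refine mem_words.2 ⟨hw.2, fun i hi => Finset.mem_biUnion.2 ⟨w, hw.1, by simpa using hi⟩⟩
  obtain ⟨s, hs⟩ := summable_iff_vanishing_norm.1 hsum η hη
  refine ⟨s.biUnion List.toFinset, fun A hA => ?_⟩
  have h1 := hs A (Finset.disjoint_left.2 fun w hw hws => (hA w hw).2 fun i hi =>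
    Finset.mem_biUnion.2 ⟨w, hws, by simpa using hi⟩)
  refine lt_of_le_of_lt (le_of_eq ?_) ((le_abs_self _).trans_lt h1)
  exact Finset.sum_congr rfl fun w hw => by simp [c, (hA w hw).1]

/-! ### Norm bounds for homogeneous polynomials -/

/-- The words of length k in a row contraction again form a row contraction, by peeling off first
letters. -/
lemma sum_nsq_wordProd_le {κ : Type*} [Fintype κ] [DecidableEq κ] {X : Λ → Matrix κ κ ℂ}
    (hX : RowBound 1 X) (F : Finset Λ) (k : ℕ) (v : κ → ℂ) :
    ∑ w ∈ words F k, nsq ((wordProd X w)ᴴ *ᵥ v) ≤ nsq v := by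
  induction k generalizing v with
  | zero => simp [words, wordProd_nil]
  | succ k ih =>
    rw [sum_words_succ]
    calc ∑ i ∈ F, ∑ w ∈ words F k, nsq ((wordProd X (i :: w))ᴴ *ᵥ v)
        ≤ ∑ i ∈ F, nsq ((X i)ᴴ *ᵥ v) := Finset.sum_le_sum fun i _ => by
          simp only [wordProd_cons, Matrix.conjTranspose_mul, ← Matrix.mulVec_mulVec]
          exact ih _
      _ ≤ nsq v := by simpa using hX F v

/-- Cauchy–Schwarz against the row contraction of words of length k: the sup norm of a homogeneous
polynomial is at most the ℓ² norm of its coefficients. -/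
lemma norm_sum_wordProd_le {n : ℕ} {X : Tuple Λ n} (hX : RowBound 1 X) {k : ℕ}
    (A : Finset (List Λ)) (hA : ∀ w ∈ A, w.length = k) (a : List Λ → ℂ) :
    ‖∑ w ∈ A, a w • wordProd X w‖ ≤ Real.sqrt (∑ w ∈ A, ‖a w‖ ^ 2) := by
  have h0 : 0 ≤ ∑ w ∈ A, ‖a w‖ ^ 2 := Finset.sum_nonneg fun _ _ => by positivity
  rw [← Matrix.l2_opNorm_conjTranspose]
  refine norm_le_of_nsq_le (Real.sqrt_nonneg _) fun v => ?_
  rw [Real.sq_sqrt h0]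
  have h1 : (∑ w ∈ A, a w • wordProd X w)ᴴ *ᵥ v =
      ∑ w ∈ A, star (a w) • ((wordProd X w)ᴴ *ᵥ v) := by
    rw [Matrix.conjTranspose_sum, Matrix.sum_mulVec]
    simp [Matrix.conjTranspose_smul, Matrix.smul_mulVec]
  rw [h1]
  refine (nsq_sum_smul_le _ _ _).trans ?_
  simp only [norm_star]
  gcongr
  refine le_trans ?_ (sum_nsq_wordProd_le hX (A.biUnion List.toFinset) k v)
  refine Finset.sum_le_sum_of_subset_of_nonneg (fun w hw => ?_) fun _ _ _ => nsq_nonneg _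
  exact mem_words.2 ⟨hA w hw, fun i hi => Finset.mem_biUnion.2 ⟨w, hw, by simpa using hi⟩⟩

end words

open scoped Kronecker

/-! ### Weighted cyclic shifts -/

section cyclic

/-- The weighted cyclic shift on `ℂ^(m+1)` with `m` weights `a` and one weight `e`. -/
def cyclicShift (m : ℕ) (a e : ℂ) : Matrix (Fin (m + 1)) (Fin (m + 1)) ℂ :=
  Matrix.of fun j l => Fin.cases (if j = Fin.last m then e else 0)
    (fun l' => if j = Fin.castSucc l' then a else 0) l

lemma cyclicShift_zero (m : ℕ) (a e : ℂ) (j : Fin (m + 1)) :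
    cyclicShift m a e j 0 = if j = Fin.last m then e else 0 := rfl

lemma cyclicShift_succ (m : ℕ) (a e : ℂ) (j : Fin (m + 1)) (l : Fin m) :
    cyclicShift m a e j l.succ = if j = Fin.castSucc l then a else 0 := rfl

lemma cyclicShift_sub (m : ℕ) (a e : ℂ) :
    cyclicShift m a e - cyclicShift m a 0 = cyclicShift m 0 e := by
  ext j l
  rw [Matrix.sub_apply]
  refine Fin.cases ?_ (fun l => ?_) l
  · simp [cyclicShift_zero]
  · simp [cyclicShift_succ]

lemma nsq_cyclicShift_le (m : ℕ) {a e : ℂ} {c : ℝ} (ha : ‖a‖ ≤ c) (he : ‖e‖ ≤ c)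
    (v : Fin (m + 1) → ℂ) : nsq ((cyclicShift m a e)ᴴ *ᵥ v) ≤ c ^ 2 * nsq v := by
  have h0 : ((cyclicShift m a e)ᴴ *ᵥ v) 0 = star e * v (Fin.last m) := by
    simp only [Matrix.mulVec, dotProduct, Matrix.conjTranspose_apply, cyclicShift_zero]
    rw [Finset.sum_eq_single (Fin.last m)]
    · simp
    · intro b _ hb; simp [hb]
    · simp
  have h1 (l : Fin m) : ((cyclicShift m a e)ᴴ *ᵥ v) l.succ = star a * v l.castSucc := by
    simp only [Matrix.mulVec, dotProduct, Matrix.conjTranspose_apply, cyclicShift_succ]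
    rw [Finset.sum_eq_single l.castSucc]
    · simp
    · intro b _ hb; simp [hb]
    · simp
  rw [nsq, nsq, Fin.sum_univ_succ, Fin.sum_univ_castSucc, h0, mul_add, add_comm, Finset.mul_sum]
  simp only [h1, norm_mul, norm_star, mul_pow]
  gcongr

/-- The corner weight r^(m+1) is what closes up (1, r, …, r^m) to an eigenvector with eigenvalue r.
-/
lemma sum_cyclicShift_mul_pow (m : ℕ) (r : ℂ) (j : Fin (m + 1)) :
    ∑ l, cyclicShift m 1 (r ^ (m + 1)) j l * r ^ (l : ℕ) = r ^ ((j : ℕ) + 1) := by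
  rw [Fin.sum_univ_succ, cyclicShift_zero]
  simp only [cyclicShift_succ]
  refine Fin.lastCases ?_ (fun j => ?_) j
  · simp [(Fin.castSucc_lt_last _).ne']
  · simp [(Fin.castSucc_lt_last _).ne, Fin.castSucc_inj]

lemma cyclicShift_pow_apply (m k : ℕ) (j l : Fin (m + 1)) :
    (cyclicShift m 1 0 ^ k) j l = if (l : ℕ) = j + k then 1 else 0 := by
  induction k generalizing l with
  | zero => simp [Matrix.one_apply, Fin.ext_iff, eq_comm]
  | succ k ih =>
    rw [pow_succ, Matrix.mul_apply]
    refine Fin.cases ?_ (fun l => ?_) l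
    · simp [cyclicShift_zero]
    · simp only [cyclicShift_succ, ih]
      rw [Finset.sum_eq_single l.castSucc]
      · simp [← add_assoc]
      · intro b _ hb; simp [hb]
      · simp

lemma cyclicShift_pow_eq_zero (m : ℕ) : cyclicShift m 1 0 ^ (m + 1) = 0 := by
  ext j l
  rw [cyclicShift_pow_apply, if_neg (by omega), Matrix.zero_apply]

end cyclic

/-! ### Kronecker products with a row contraction -/

section kronecker

variable {Λ : Type u} {ι κ : Type*} [Fintype ι] [Fintype κ]

/-- Apply Aᴴ in the second tensor factor first; the row bound for X then applies to each slice u l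
separately. -/
lemma RowBound.kronecker {X : Λ → Matrix ι ι ℂ} {c d : ℝ} (hX : RowBound c X) {A : Matrix κ κ ℂ}
    (hA : ∀ v, nsq (Aᴴ *ᵥ v) ≤ d ^ 2 * nsq v) : RowBound (c * d) (fun i => X i ⊗ₖ A) :=
  fun s v => by
  let u : κ → ι → ℂ := fun l a => (Aᴴ *ᵥ fun j => v (a, j)) l
  have h1 (i : Λ) : nsq ((X i ⊗ₖ A)ᴴ *ᵥ v) = ∑ l, nsq ((X i)ᴴ *ᵥ u l) := by
    unfold nsq
    rw [Fintype.sum_prod_type, Finset.sum_comm]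
    refine Finset.sum_congr rfl fun l _ => Finset.sum_congr rfl fun b _ => ?_
    congr 2
    simp only [Matrix.mulVec, dotProduct, Matrix.conjTranspose_apply, Matrix.kroneckerMap_apply,
      Fintype.sum_prod_type, u, Finset.mul_sum, star_mul']
    exact Finset.sum_congr rfl fun a _ => Finset.sum_congr rfl fun j _ => by ring
  have h2 : ∑ l, nsq (u l) = ∑ a, nsq (Aᴴ *ᵥ fun j => v (a, j)) := Finset.sum_comm
  simp only [h1]
  rw [Finset.sum_comm]
  calc ∑ l, ∑ i ∈ s, nsq ((X i)ᴴ *ᵥ u l) ≤ ∑ l, c ^ 2 * nsq (u l) :=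
        Finset.sum_le_sum fun l _ => hX s _
    _ = c ^ 2 * ∑ a, nsq (Aᴴ *ᵥ fun j => v (a, j)) := by rw [← Finset.mul_sum, h2]
    _ ≤ c ^ 2 * ∑ a, d ^ 2 * nsq (fun j => v (a, j)) := by gcongr with a; exact hA _
    _ = (c * d) ^ 2 * nsq v := by
        rw [← Finset.mul_sum]
        unfold nsq
        rw [Fintype.sum_prod_type]
        ring

lemma wordProd_kronecker [DecidableEq ι] [DecidableEq κ] (X : Λ → Matrix ι ι ℂ) (A : Matrix κ κ ℂ)
    (w : List Λ) : wordProd (fun i => X i ⊗ₖ A) w = wordProd X w ⊗ₖ (A ^ w.length) := by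
  induction w with
  | nil => simp [wordProd_nil]
  | cons i w ih =>
    rw [wordProd_cons, ih, ← Matrix.mul_kronecker_mul, ← wordProd_cons, List.length_cons, pow_succ']

/-- The embedding `v ↦ v ⊗ (1, r, r², …)`. -/
def geomEmbed (ι : Type*) [DecidableEq ι] (m : ℕ) (r : ℂ) : Matrix (ι × Fin (m + 1)) ι ℂ :=
  Matrix.of fun p b => if p.1 = b then r ^ (p.2 : ℕ) else 0

lemma geomEmbed_mulVec [DecidableEq ι] (m : ℕ) (r : ℂ) (v : ι → ℂ) (p : ι × Fin (m + 1)) :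
    (geomEmbed ι m r *ᵥ v) p = r ^ (p.2 : ℕ) * v p.1 := by
  simp [geomEmbed, Matrix.mulVec, dotProduct]

lemma kronecker_mul_geomEmbed [DecidableEq ι] (m : ℕ) (r : ℂ) (B : Matrix ι ι ℂ) :
    geomEmbed ι m r * (r • B) = (B ⊗ₖ cyclicShift m 1 (r ^ (m + 1))) * geomEmbed ι m r := by
  ext ⟨a, j⟩ b
  have h1 := sum_cyclicShift_mul_pow m r j
  simp only [Matrix.mul_apply, geomEmbed, Matrix.of_apply, Matrix.kroneckerMap_apply,
    Fintype.sum_prod_type, mul_ite, mul_zero, ite_mul, zero_mul]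
  rw [Finset.sum_comm]
  simp only [Finset.sum_ite_eq', Finset.mem_univ, if_true, Finset.sum_ite_eq, Matrix.smul_apply,
    smul_eq_mul, mul_assoc, ← Finset.mul_sum, h1]
  ring

/-- The bound is independent of m, so that m may be chosen after the modulus of continuity. -/
lemma nsq_geomEmbed_le [DecidableEq ι] (m : ℕ) {r : ℝ} (h0 : 0 ≤ r) (h1 : r < 1) (v : ι → ℂ) :
    nsq (geomEmbed ι m r *ᵥ v) ≤ nsq v / (1 - r ^ 2) := by
  have h2 : r ^ 2 < 1 := by nlinarith
  have h3 : nsq (geomEmbed ι m r *ᵥ v) = nsq v * ∑ j ∈ Finset.range (m + 1), (r ^ 2) ^ j := by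
    rw [nsq, nsq, Fintype.sum_prod_type, Finset.sum_mul, Finset.sum_range]
    refine Finset.sum_congr rfl fun a _ => ?_
    rw [Finset.mul_sum]
    refine Finset.sum_congr rfl fun j _ => ?_
    rw [geomEmbed_mulVec]
    simp only [norm_mul, norm_pow, mul_pow, Complex.norm_real, Real.norm_of_nonneg h0]
    rw [← pow_mul, ← pow_mul, mul_comm 2]
    ring
  rw [h3, div_eq_mul_inv]
  refine mul_le_mul_of_nonneg_left ?_ (nsq_nonneg v)
  rw [← tsum_geometric_of_lt_one (by positivity) h2]
  exact (summable_geometric_of_lt_one (by positivity) h2).sum_le_tsum _ fun _ _ => by positivity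

end kronecker

/-! ### Approximation by Taylor polynomials -/

section approximation

variable {Λ : Type u} [DecidableEq Λ]

lemma exists_norm_sub_taylor_le (f : discAlgebra Λ) {r : ℝ} (hr0 : 0 < r) (hr1 : r < 1) {ε : ℝ}
    (hε : 0 < ε) : ∃ m : ℕ, ∀ (n : ℕ) (X : ballLevel Λ n) (F : Finset Λ), (∀ i ∉ F, X.1 i = 0) →
      ‖evalAt f ((r : ℂ) • X.1) -
        ∑ w ∈ wordsBelow F m, (r ^ w.length * coeff f w) • wordProd X.1 w‖ ≤ ε := by
  have hr2 : 0 < 1 - r ^ 2 := by nlinarith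
  -- The factor √(1 - r²) compensates for the norm of `geomEmbed`.
  obtain ⟨δ, hδ, h⟩ := norm_sub_le_evalAt.{u, 0} f (ε := ε * Real.sqrt (1 - r ^ 2)) (by positivity)
  obtain ⟨m, hm⟩ := exists_pow_lt_of_lt_one hδ hr1
  refine ⟨m + 1, fun n X F hF => norm_le_of_nsq_le hε.le fun v => ?_⟩
  obtain ⟨⟨a0⟩, c, hc0, hc1, hc⟩ := mem_ballLevel_iff.1 X.2
  let e : ℂ := (r : ℂ) ^ (m + 1)
  have he : ‖e‖ = r ^ (m + 1) := by simp [e, abs_of_pos hr0]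
  let Y : ℂ → Λ → Matrix (Fin n × Fin (m + 1)) (Fin n × Fin (m + 1)) ℂ :=
    fun e i => X.1 i ⊗ₖ cyclicShift m 1 e
  have hY {e : ℂ} (he : ‖e‖ ≤ 1) : InBall (Y e) :=
    ⟨⟨(a0, 0)⟩, c, hc0, hc1, by
      simpa using hc.kronecker (d := 1) fun v => nsq_cyclicShift_le m (by simp) he v⟩
  have hYe : InBall (Y e) := hY (by rw [he]; exact pow_le_one₀ hr0.le hr1.le)
  have hY0 : InBall (Y 0) := hY (by simp)
  have hsub : RowBound (c * r ^ (m + 1)) (Y e - Y 0) := by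
    have : Y e - Y 0 = fun i => X.1 i ⊗ₖ cyclicShift m 0 e := by
      funext i
      rw [← cyclicShift_sub m 1 e]
      ext p q
      simp [Y, mul_sub]
    rw [this]
    exact hc.kronecker fun v => nsq_cyclicShift_le m (by simp; positivity) he.le v
  have hlt : c * r ^ (m + 1) < δ := by
    have : r ^ (m + 1) ≤ r ^ m := pow_le_pow_of_le_one hr0.le hr1.le (Nat.le_succ m)
    have h3 : c * r ^ (m + 1) ≤ 1 * r ^ (m + 1) := by gcongr
    linarith
  have h1 := h (Y e) (Y 0) hYe hY0 _ (by positivity) hlt hsub (geomEmbed (Fin n) m r *ᵥ v)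
  have hrX : InBall ((r : ℂ) • X.1) := by
    refine ⟨⟨a0⟩, _, by positivity, ?_, hc.smul (r : ℂ)⟩
    rw [Complex.norm_real, Real.norm_of_nonneg hr0.le]
    nlinarith
  have h2 := evalAt_intertwine f hrX hYe (geomEmbed (Fin n) m r) fun i =>
    kronecker_mul_geomEmbed m r _
  -- Without the corner weight the shift is nilpotent of order m + 1, so only words of length at
  -- most m contribute to f(Y 0).
  have h3 := evalAt_eq_sum f (isSuffixClosed_wordsBelow F m) hY0 fun w hw i hi => by
    by_cases hiF : i ∈ F
    · rw [mem_wordsBelow] at hw hi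
      have : (i :: w).length = m + 1 := by
        by_contra hne
        refine hi ⟨?_, fun j hj => ?_⟩
        · rw [List.length_cons] at hne ⊢; omega
        · rcases List.mem_cons.1 hj with rfl | hj
          · exact hiF
          · exact hw.2 j hj
      rw [wordProd_kronecker, this, cyclicShift_pow_eq_zero, Matrix.kronecker_zero]
    · exact wordProd_eq_zero (i := i) (by simp [Y, hF i hiF]) List.mem_cons_self
  -- Read off the coordinate 0 of the second factor: f(Y e) returns f(rX)v there since `geomEmbed`
  -- intertwines, and the power |w| of the nilpotent shift picks out the weight r^|w|.
  have h4 (a : Fin n) :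
      ((evalAt f (Y e) - evalAt f (Y 0)) *ᵥ (geomEmbed (Fin n) m r *ᵥ v)) (a, 0) =
      ((evalAt f ((r : ℂ) • X.1) -
        ∑ w ∈ wordsBelow F (m + 1), (r ^ w.length * coeff f w) • wordProd X.1 w) *ᵥ v) a := by
    rw [Matrix.sub_mulVec, Matrix.sub_mulVec, Matrix.mulVec_mulVec, ← h2, ← Matrix.mulVec_mulVec,
      Pi.sub_apply, Pi.sub_apply, geomEmbed_mulVec, h3, Matrix.sum_mulVec, Matrix.sum_mulVec,
      Finset.sum_apply, Finset.sum_apply]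
    congr 1
    · simp
    · refine Finset.sum_congr rfl fun w hw => ?_
      have hlen : w.length < m + 1 := (mem_wordsBelow.1 hw).1
      rw [Matrix.smul_mulVec, Matrix.smul_mulVec, wordProd_kronecker, Pi.smul_apply, Pi.smul_apply]
      have h6 (M : Matrix (Fin n × Fin (m + 1)) (Fin n × Fin (m + 1)) ℂ) (u) :
          (M *ᵥ u) (a, 0) = ∑ b, ∑ l, M (a, 0) (b, l) * u (b, l) := Fintype.sum_prod_type _
      simp only [h6, geomEmbed_mulVec, Matrix.kroneckerMap_apply, cyclicShift_pow_apply]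
      have h5 (b : Fin n) : ∑ l : Fin (m + 1), wordProd X.1 w a b *
          (if (l : ℕ) = (0 : Fin (m + 1)) + w.length then 1 else 0) * ((r : ℂ) ^ (l : ℕ) * v b) =
          (r : ℂ) ^ w.length * (wordProd X.1 w a b * v b) := by
        rw [Finset.sum_eq_single ⟨w.length, hlen⟩]
        · simp; ring
        · intro l _ hl
          rw [if_neg]
          · simp
          · intro hl'
            exact hl (Fin.ext (by simpa using hl'))
        · simp
      simp only [h5, ← Finset.mul_sum]
      simp only [Matrix.mulVec, dotProduct, smul_eq_mul]
      ring
  calc _ = ∑ a, ‖((evalAt f (Y e) - evalAt f (Y 0)) *ᵥ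
          (geomEmbed (Fin n) m r *ᵥ v)) (a, 0)‖ ^ 2 := by
        simp only [h4]; rfl
    _ ≤ nsq ((evalAt f (Y e) - evalAt f (Y 0)) *ᵥ (geomEmbed (Fin n) m r *ᵥ v)) := by
        rw [nsq, Fintype.sum_prod_type]
        refine Finset.sum_le_sum fun a _ => ?_
        exact Finset.single_le_sum (f := fun j : Fin (m + 1) =>
          ‖((evalAt f (Y e) - evalAt f (Y 0)) *ᵥ (geomEmbed (Fin n) m r *ᵥ v)) (a, j)‖ ^ 2)
          (fun _ _ => by positivity) (Finset.mem_univ 0)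
    _ ≤ _ := h1
    _ ≤ (ε * Real.sqrt (1 - r ^ 2)) ^ 2 * (nsq v / (1 - r ^ 2)) := by
        gcongr
        exact nsq_geomEmbed_le m hr0.le hr1 v
    _ = ε ^ 2 * nsq v := by
        rw [mul_pow, Real.sq_sqrt hr2.le]
        field_simp

end approximation

/-! ### Truncation of a tuple to finitely many letters -/

section restriction

variable {Λ : Type u} [DecidableEq Λ]

/-- The tuple obtained by replacing the entries outside `F` by zero. -/
def restr {κ : Type*} (F : Finset Λ) (X : Λ → Matrix κ κ ℂ) : Λ → Matrix κ κ ℂ :=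
  fun i => if i ∈ F then X i else 0

lemma wordProd_restr {κ : Type*} [Fintype κ] [DecidableEq κ] {F : Finset Λ}
    (X : Λ → Matrix κ κ ℂ) {w : List Λ} (hw : ∀ i ∈ w, i ∈ F) :
    wordProd (restr F X) w = wordProd X w := by
  unfold wordProd
  congr 1
  exact List.map_congr_left fun i hi => if_pos (hw i hi)

lemma RowBound.restr {κ : Type*} [Fintype κ] {X : Λ → Matrix κ κ ℂ} {c : ℝ} (h : RowBound c X)
    (F : Finset Λ) : RowBound c (restr F X) := fun s v => by
  refine (Finset.sum_le_sum fun i _ => ?_).trans (h s v)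
  unfold NCBall.restr
  split_ifs
  · exact le_rfl
  · simpa [nsq] using nsq_nonneg ((X i)ᴴ *ᵥ v)

/-- The matrix size is finite, so the squared Hilbert–Schmidt norms g i of the entries are summable
and dominate the tails. The set F₀ depends on X. -/
lemma exists_rowBound_sub_restr {κ : Type*} [Fintype κ] [DecidableEq κ] {X : Λ → Matrix κ κ ℂ}
    {c : ℝ} (h : RowBound c X) {δ : ℝ} (hδ : 0 < δ) :
    ∃ F₀ : Finset Λ, ∀ F, F₀ ⊆ F → RowBound δ (X - NCBall.restr F X) := by
  let g : Λ → ℝ := fun i => ∑ a, nsq ((X i)ᴴ *ᵥ Pi.single a 1)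
  have hg0 (i : Λ) : 0 ≤ g i := Finset.sum_nonneg fun _ _ => nsq_nonneg _
  have hg : Summable g := by
    refine summable_of_sum_le hg0 (c := ∑ _a : κ, c ^ 2) fun s => ?_
    rw [Finset.sum_comm]
    refine Finset.sum_le_sum fun a _ => ?_
    simpa [nsq_single] using h s (Pi.single a 1)
  have hv (i : Λ) (v : κ → ℂ) : nsq ((X i)ᴴ *ᵥ v) ≤ nsq v * g i := by
    have : (X i)ᴴ *ᵥ v = ∑ a, v a • ((X i)ᴴ *ᵥ Pi.single a 1) := by
      simp only [← Matrix.mulVec_smul, ← Matrix.mulVec_sum]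
      congr 1
      ext b
      simp [Finset.sum_apply, Pi.single_apply]
    rw [this]
    exact nsq_sum_smul_le _ _ _
  obtain ⟨F₀, hF₀⟩ := summable_iff_vanishing_norm.1 hg (δ ^ 2) (by positivity)
  refine ⟨F₀, fun F hF s v => ?_⟩
  have h1 := hF₀ (s \ F) (Finset.disjoint_left.2 fun i hi hi' =>
    (Finset.mem_sdiff.1 hi).2 (hF hi'))
  have h2 : ∑ i ∈ s, nsq (((X - NCBall.restr F X) i)ᴴ *ᵥ v) =
      ∑ i ∈ s \ F, nsq ((X i)ᴴ *ᵥ v) := by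
    rw [← Finset.sum_subset (Finset.sdiff_subset (s := s) (t := F)) fun i hi hi' => ?_]
    · refine Finset.sum_congr rfl fun i hi => ?_
      simp [NCBall.restr, (Finset.mem_sdiff.1 hi).2]
    · have : i ∈ F := by
        by_contra hF
        exact hi' (Finset.mem_sdiff.2 ⟨hi, hF⟩)
      simp [NCBall.restr, this, nsq]
  rw [h2]
  calc _ ≤ ∑ i ∈ s \ F, nsq v * g i := Finset.sum_le_sum fun i _ => hv i v
    _ = (∑ i ∈ s \ F, g i) * nsq v := by rw [← Finset.mul_sum, mul_comm]
    _ ≤ _ := by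
      have := nsq_nonneg v
      gcongr
      exact (le_abs_self _).trans h1.le

end restriction

/-! ### Uniform approximation by dilated Taylor polynomials -/

section taylor

variable {Λ : Type u}

/-- Evaluation at a point of the ball, as a homomorphism. -/
def evalHom (X : Ball Λ) : discAlgebra Λ →ₐ[ℂ] Matrix (Fin X.1) (Fin X.1) ℂ :=
  (Pi.evalAlgHom ℂ (fun X : Ball Λ => Matrix (Fin X.1) (Fin X.1) ℂ) X).comp (discAlgebra Λ).val

lemma evalHom_monomial (X : Ball Λ) (w : List Λ) : evalHom X (monomial w) = wordProd X.2.1 w :=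
  monomial_apply w X

variable [DecidableEq Λ]

/-- The part of the Taylor expansion with words of length `k` in the letters from `F`. -/
def taylor (f : discAlgebra Λ) (F : Finset Λ) (k : ℕ) : discAlgebra Λ :=
  ∑ w ∈ words F k, coeff f w • monomial w

lemma evalHom_taylor (f : discAlgebra Λ) (F : Finset Λ) (k : ℕ) (X : Ball Λ) :
    evalHom X (taylor f F k) = ∑ w ∈ words F k, coeff f w • wordProd X.2.1 w := by
  simp [taylor, evalHom_monomial]

/-- The Taylor polynomials, dilated by `r < 1`, are dense. -/
lemma exists_taylor_approx (f : discAlgebra Λ) {ε : ℝ} (hε : 0 < ε) :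
    ∃ (r : ℂ) (m : ℕ) (G₀ : Finset Λ), ∀ G, G₀ ⊆ G → ∀ X : Ball Λ,
      ‖(f - ∑ k ∈ Finset.range m, r ^ k • taylor f G k).1 X‖ ≤ ε := by
  -- Four errors of ε/4: dilating X to rX, truncating to the letters of F, replacing f by its Taylor
  -- polynomial, and passing from the letters of F to those of H.
  obtain ⟨δ, hδ, hf⟩ := f.2.2 (ε / 4) (by positivity)
  obtain ⟨r, hr0, hr1, hrδ⟩ : ∃ r : ℝ, 0 < r ∧ r < 1 ∧ 1 - r < δ := by
    refine ⟨max (1 / 2) (1 - δ / 2), by positivity, max_lt (by norm_num) (by linarith), ?_⟩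
    have := le_max_right (1 / 2) (1 - δ / 2)
    linarith
  obtain ⟨m, hm⟩ := exists_norm_sub_taylor_le f hr0 hr1 (ε := ε / 4) (by positivity)
  have hη : 0 < ε / (4 * (m + 1)) := by positivity
  choose G hG using fun k => exists_sum_coeff_lt f k (η := (ε / (4 * (m + 1))) ^ 2) (by positivity)
  refine ⟨r, m, (Finset.range m).biUnion G, fun H hH => ?_⟩
  rintro ⟨n, X⟩
  obtain ⟨hn, c, hc0, hc1, hc⟩ := mem_ballLevel_iff.1 X.2
  have hrn : ‖(r : ℂ)‖ = r := by simp [abs_of_pos hr0]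
  obtain ⟨F₀, hF₀⟩ := exists_rowBound_sub_restr hc (δ := δ / 2) (by positivity)
  -- F depends on the point X, while H must not. The coefficients of words not in the letters of H
  -- are small in ℓ², so the return from F to H is uniform in X.
  let F := F₀ ∪ H
  let X' : ballLevel Λ n := ⟨restr F X.1, mem_ballLevel_iff.2 ⟨hn, c, hc0, hc1, hc.restr F⟩⟩
  let rX : ballLevel Λ n := scale r (by rw [hrn]; exact hr1.le) X
  let rX' : ballLevel Λ n := scale r (by rw [hrn]; exact hr1.le) X'
  have e1 : ‖f.1 ⟨n, X⟩ - f.1 ⟨n, rX⟩‖ ≤ ε / 4 := by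
    refine (hf n X rX (rowNorm_lt_of_rowBound (c := (1 - r) * c)
      (mul_nonneg (by linarith) hc0) (by nlinarith) ?_)).le
    have h1 : X.1 - rX.1 = ((1 - r : ℝ) : ℂ) • X.1 := by
      simp [rX, scale, sub_smul]
    rw [h1]
    have := hc.smul ((1 - r : ℝ) : ℂ)
    rwa [Complex.norm_real, Real.norm_of_nonneg (by linarith)] at this
  have e2 : ‖f.1 ⟨n, rX⟩ - f.1 ⟨n, rX'⟩‖ ≤ ε / 4 := by
    refine (hf n rX rX' (rowNorm_lt_of_rowBound (c := r * (δ / 2)) (by positivity)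
      (by nlinarith) ?_)).le
    have h1 : rX.1 - rX'.1 = (r : ℂ) • (X.1 - restr F X.1) := (smul_sub _ _ _).symm
    rw [h1]
    have := (hF₀ F Finset.subset_union_left).smul (r : ℂ)
    rwa [hrn] at this
  have e3 := hm n X' F fun i hi => if_neg hi
  have h4 : evalAt f ((r : ℂ) • X'.1) = f.1 ⟨n, rX'⟩ := evalAt_fin f rX'
  rw [h4] at e3
  have hT (H' : Finset Λ) (X' : ballLevel Λ n) :
      ∑ w ∈ wordsBelow H' m, ((r : ℂ) ^ w.length * coeff f w) • wordProd X'.1 w =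
        ∑ k ∈ Finset.range m, (r : ℂ) ^ k • ∑ w ∈ words H' k, coeff f w • wordProd X'.1 w := by
    rw [sum_wordsBelow]
    refine Finset.sum_congr rfl fun k _ => ?_
    rw [Finset.smul_sum]
    refine Finset.sum_congr rfl fun w hw => ?_
    rw [(mem_words.1 hw).1, smul_smul]
  have e4 : ‖∑ w ∈ wordsBelow F m, ((r : ℂ) ^ w.length * coeff f w) • wordProd X'.1 w -
      ∑ w ∈ wordsBelow H m, ((r : ℂ) ^ w.length * coeff f w) • wordProd X.1 w‖ ≤ ε / 4 := by
    have h5 : ∑ w ∈ wordsBelow F m, ((r : ℂ) ^ w.length * coeff f w) • wordProd X'.1 w =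
        ∑ w ∈ wordsBelow F m, ((r : ℂ) ^ w.length * coeff f w) • wordProd X.1 w :=
      Finset.sum_congr rfl fun w hw => by rw [wordProd_restr _ (mem_wordsBelow.1 hw).2]
    rw [h5, hT, hT, ← Finset.sum_sub_distrib]
    refine (norm_sum_le _ _).trans ?_
    have h6 : ∀ k ∈ Finset.range m, ‖(r : ℂ) ^ k • ∑ w ∈ words F k, coeff f w • wordProd X.1 w -
        (r : ℂ) ^ k • ∑ w ∈ words H k, coeff f w • wordProd X.1 w‖ ≤ ε / (4 * (m + 1)) := by
      intro k hk
      have hsub : words H k ⊆ words F k := fun w hw => by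
        rw [mem_words] at hw ⊢
        exact ⟨hw.1, fun i hi => Finset.mem_union_right _ (hw.2 i hi)⟩
      rw [← smul_sub, ← Finset.sum_sdiff hsub, add_sub_cancel_right, norm_smul, norm_pow, hrn]
      have h7 := norm_sum_wordProd_le (hc.mono hc0 hc1.le) (k := k) (words F k \ words H k)
        (fun w hw => (mem_words.1 (Finset.mem_sdiff.1 hw).1).1) (coeff f)
      have h8 := hG k (words F k \ words H k) fun w hw => by
        rw [Finset.mem_sdiff, mem_words, mem_words] at hw
        refine ⟨hw.1.1, fun hi => hw.2 ⟨hw.1.1, fun i hi' => hH ?_⟩⟩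
        exact Finset.mem_biUnion.2 ⟨k, hk, hi i hi'⟩
      have h9 := Real.sqrt_le_sqrt h8.le
      rw [Real.sqrt_sq hη.le] at h9
      calc _ ≤ 1 * (ε / (4 * (m + 1))) := by
            gcongr
            · exact pow_le_one₀ hr0.le hr1.le
            · exact h7.trans h9
        _ = _ := one_mul _
    refine (Finset.sum_le_sum h6).trans ?_
    rw [Finset.sum_const, Finset.card_range, nsmul_eq_mul, ← mul_div_assoc,
      div_le_div_iff₀ (by positivity) (by positivity)]
    nlinarith
  have hsplit : (f - ∑ k ∈ Finset.range m, (r : ℂ) ^ k • taylor f H k).1 ⟨n, X⟩ =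
      (f.1 ⟨n, X⟩ - f.1 ⟨n, rX⟩) + (f.1 ⟨n, rX⟩ - f.1 ⟨n, rX'⟩) +
      (f.1 ⟨n, rX'⟩ -
        ∑ w ∈ wordsBelow F m, ((r : ℂ) ^ w.length * coeff f w) • wordProd X'.1 w) +
      (∑ w ∈ wordsBelow F m, ((r : ℂ) ^ w.length * coeff f w) • wordProd X'.1 w -
        ∑ w ∈ wordsBelow H m, ((r : ℂ) ^ w.length * coeff f w) • wordProd X.1 w) := by
    have h10 : (f - ∑ k ∈ Finset.range m, (r : ℂ) ^ k • taylor f H k).1 ⟨n, X⟩ = f.1 ⟨n, X⟩ -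
        ∑ k ∈ Finset.range m, (r : ℂ) ^ k • ∑ w ∈ words H k, coeff f w • wordProd X.1 w := by
      refine (map_sub (evalHom ⟨n, X⟩) _ _).trans (congrArg₂ (· - ·) rfl
        ((map_sum (evalHom ⟨n, X⟩) _ _).trans (Finset.sum_congr rfl fun k _ => ?_)))
      exact (map_smul (evalHom ⟨n, X⟩) _ _).trans
        (congrArg (fun M => (r : ℂ) ^ k • M) (evalHom_taylor f H k ⟨n, X⟩))
    rw [h10, hT H X]
    abel
  rw [hsplit]
  refine (norm_add_le _ _).trans ?_
  have n1 := norm_add_le ((f.1 ⟨n, X⟩ - f.1 ⟨n, rX⟩) + (f.1 ⟨n, rX⟩ - f.1 ⟨n, rX'⟩)) (f.1 ⟨n, rX'⟩ -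
        ∑ w ∈ wordsBelow F m, ((r : ℂ) ^ w.length * coeff f w) • wordProd X'.1 w)
  have n2 := norm_add_le (f.1 ⟨n, X⟩ - f.1 ⟨n, rX⟩) (f.1 ⟨n, rX⟩ - f.1 ⟨n, rX'⟩)
  linarith

end taylor

/-! ### Homogeneous components of polynomials -/

section homogComponent

variable {Λ : Type u}

lemma continuous_rotate (f : discAlgebra Λ) (X : Ball Λ) :
    Continuous (X := ℝ) (Y := Matrix (Fin X.1) (Fin X.1) ℂ) fun θ =>
      f.1 ⟨X.1, scale (Complex.exp (θ * Complex.I)) (Complex.norm_exp_ofReal_mul_I θ).le X.2⟩ := by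
  rw [Metric.continuous_iff]
  intro θ ε hε
  obtain ⟨δ, hδ, h⟩ := f.2.2 ε hε
  have hc : Continuous fun θ : ℝ => Complex.exp (θ * Complex.I) := by fun_prop
  obtain ⟨η, hη, hd⟩ := Metric.continuous_iff.1 hc θ δ hδ
  refine ⟨η, hη, fun φ hφ => ?_⟩
  rw [dist_eq_norm]
  refine h X.1 _ _ ?_
  have h1 := hd φ hφ
  rw [dist_eq_norm] at h1
  simp only [scale, ← sub_smul]
  rw [rowNorm_smul]
  calc _ ≤ ENNReal.ofReal ‖Complex.exp (φ * Complex.I) - Complex.exp (θ * Complex.I)‖ * 1 := by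
        gcongr
        exact X.2.2.2.le
    _ < ENNReal.ofReal δ := by
        rw [mul_one]
        exact (ENNReal.ofReal_lt_ofReal_iff hδ).2 h1

lemma intervalIntegrable_rotate (f : discAlgebra Λ) (X : Ball Λ) (k : ℕ) (a b : Fin X.1) (s t : ℝ) :
    IntervalIntegrable (fun θ : ℝ => f.1 ⟨X.1, scale (Complex.exp (θ * Complex.I))
      (Complex.norm_exp_ofReal_mul_I θ).le X.2⟩ a b * Complex.exp (-(k * θ * Complex.I)))
      MeasureTheory.volume s t := by
  refine Continuous.intervalIntegrable ?_ _ _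
  have := (continuous_rotate f X).matrix_elem a b
  exact this.mul (by fun_prop)

/-- The `k`-homogeneous component as a linear map. -/
def homogLin (k : ℕ) : discAlgebra Λ →ₗ[ℂ] GradedFun Λ where
  toFun := homogComponent k
  map_add' f g := by
    funext X
    ext a b
    simp only [homogComponent, Matrix.of_apply, Pi.add_apply, Matrix.add_apply]
    rw [← mul_add, ← intervalIntegral.integral_add (intervalIntegrable_rotate f X k a b _ _)
      (intervalIntegrable_rotate g X k a b _ _)]
    congr 2
    funext θ
    rw [← add_mul]
    rfl
  map_smul' c f := by
    funext X
    ext a b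
    simp only [homogComponent, Matrix.of_apply, Pi.smul_apply, Matrix.smul_apply,
      RingHom.id_apply, smul_eq_mul]
    rw [mul_left_comm]
    congr 1
    rw [← intervalIntegral.integral_const_mul]
    congr 1
    funext θ
    rw [← mul_assoc]
    rfl

lemma integral_exp_int_mul (n : ℤ) :
    ∫ θ in (0 : ℝ)..(2 * Real.pi), Complex.exp (n * Complex.I * θ) =
      if n = 0 then 2 * Real.pi else 0 := by
  split_ifs with h
  · simp [h]
  · have hn : (n : ℂ) * Complex.I ≠ 0 := mul_ne_zero (by exact_mod_cast h) Complex.I_ne_zero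
    rw [integral_exp_mul_complex hn]
    have : (n : ℂ) * Complex.I * ((2 * Real.pi : ℝ) : ℂ) = n * (2 * Real.pi * Complex.I) := by
      push_cast; ring
    rw [this, Complex.exp_int_mul_two_pi_mul_I]
    simp

lemma homogLin_monomial (k : ℕ) (w : List Λ) :
    homogLin k (monomial w) = if w.length = k then (monomial w).1 else 0 := by
  funext X
  ext a b
  change (1 / (2 * Real.pi) : ℂ) * (∫ θ in (0 : ℝ)..(2 * Real.pi), _) = _
  have h1 (θ : ℝ) : (monomial w).1 ⟨X.1, scale (Complex.exp (θ * Complex.I))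
      (Complex.norm_exp_ofReal_mul_I θ).le X.2⟩ a b * Complex.exp (-(k * θ * Complex.I)) =
      wordProd X.2.1 w a b * Complex.exp (((w.length - k : ℤ) : ℂ) * Complex.I * θ) := by
    rw [monomial_apply]
    simp only [scale]
    rw [wordProd_smul, Matrix.smul_apply, smul_eq_mul, ← Complex.exp_nat_mul, mul_right_comm,
      ← Complex.exp_add, mul_comm]
    congr 2
    push_cast
    ring
  simp only [h1]
  rw [intervalIntegral.integral_const_mul, integral_exp_int_mul]
  have hpi : (Real.pi : ℂ) ≠ 0 := by exact_mod_cast Real.pi_ne_zero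
  by_cases h : w.length = k
  · rw [if_pos h, if_pos (by omega), monomial_apply]
    push_cast
    field_simp
  · rw [if_neg h, if_neg (by omega)]
    simp

end homogComponent

/-! ### Quotients of the truncated shift -/

/-- B is the quotient map modulo K in coordinates, and C is a linear section of it. -/
lemma exists_matrix_ker {ι : Type*} [Fintype ι] [DecidableEq ι] (K : Submodule ℂ (ι → ℂ)) :
    ∃ (n : ℕ) (B : Matrix (Fin n) ι ℂ) (C : Matrix ι (Fin n) ℂ), B * C = 1 ∧
      ∀ v, B *ᵥ v = 0 ↔ v ∈ K := by
  let e := (Module.finBasis ℂ ((ι → ℂ) ⧸ K)).equivFun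
  let φ : (ι → ℂ) →ₗ[ℂ] _ := e.toLinearMap ∘ₗ K.mkQ
  have hφ : Function.Surjective φ := e.surjective.comp K.mkQ_surjective
  obtain ⟨ψ, hψ⟩ := φ.exists_rightInverse_of_surjective (LinearMap.range_eq_top.2 hφ)
  refine ⟨_, LinearMap.toMatrix' φ, LinearMap.toMatrix' ψ, ?_, fun v => ?_⟩
  · rw [← LinearMap.toMatrix'_comp, hψ, LinearMap.toMatrix'_id]
  · rw [LinearMap.toMatrix'_mulVec]
    simp [φ]

/-! ### Polynomials modulo the ideal and high degree -/

section algebra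

variable {Λ : Type u}

lemma monomial_append (u w : List Λ) : monomial (u ++ w) = monomial u * monomial w := by
  simp [monomial]

lemma monomial_cons (i : Λ) (w : List Λ) : monomial (i :: w) = coord i * monomial w := by
  simp [monomial]

/-- The span of the monomials of degree more than `k`. -/
def highDegree (Λ : Type u) (k : ℕ) : Submodule ℂ (discAlgebra Λ) :=
  Submodule.span ℂ (monomial '' {w : List Λ | k < w.length})

lemma coord_mul_mem_highDegree {k : ℕ} (i : Λ) {d : discAlgebra Λ} (hd : d ∈ highDegree Λ k) :
    coord i * d ∈ highDegree Λ k := by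
  have : highDegree Λ k ≤ (highDegree Λ k).comap (LinearMap.mulLeft ℂ (coord i)) := by
    refine Submodule.span_le.2 ?_
    rintro _ ⟨w, hw, rfl⟩
    refine Submodule.subset_span ⟨i :: w, ?_, monomial_cons i w⟩
    exact Nat.lt_succ_of_lt hw
  exact this hd

lemma homogLin_highDegree {k : ℕ} {d : discAlgebra Λ} (hd : d ∈ highDegree Λ k) :
    homogLin k d = 0 := by
  have : highDegree Λ k ≤ LinearMap.ker (homogLin k) := by
    refine Submodule.span_le.2 ?_
    rintro _ ⟨w, hw, rfl⟩
    rw [SetLike.mem_coe, LinearMap.mem_ker, homogLin_monomial, if_neg]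
    exact ne_of_gt hw
  exact this hd

/-- The polynomial with the given coefficients. -/
def polyOf (S : Finset (List Λ)) : (S → ℂ) →ₗ[ℂ] discAlgebra Λ :=
  Fintype.linearCombination ℂ fun w : S => monomial w.1

lemma monomial_mul_polyOf_mem {k : ℕ} {w : List Λ} (hw : k < w.length) (S : Finset (List Λ))
    (v : S → ℂ) : monomial w * polyOf S v ∈ highDegree Λ k := by
  rw [polyOf, Fintype.linearCombination_apply, Finset.mul_sum]
  refine sum_mem fun u _ => ?_
  rw [mul_smul_comm, ← monomial_append]
  refine Submodule.smul_mem _ _ (Submodule.subset_span ⟨_, ?_, rfl⟩)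
  exact hw.trans_le (by simp)

/-- The kernel of evaluation at X is a two-sided ideal, and evaluation is contractive for the sup
norm, so vanishing passes from generators to the closed ideal. -/
lemma mem_zeroLocus_of_isGeneratedBy {J : TwoSidedIdeal (discAlgebra Λ)}
    {E : Set (discAlgebra Λ)} (hgen : IsGeneratedBy J E) {X : Ball Λ}
    (hX : ∀ p ∈ E, evalHom X p = 0) : X ∈ zeroLocus (J : Set (discAlgebra Λ)) := by
  intro g hg
  rw [hgen] at hg
  have hE : TwoSidedIdeal.span E ≤ TwoSidedIdeal.ker (evalHom X) :=
    TwoSidedIdeal.span_le.2 fun p hp => (TwoSidedIdeal.mem_ker _).2 (hX p hp)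
  rw [← norm_le_zero_iff]
  refine le_of_forall_pos_le_add fun ε hε => ?_
  obtain ⟨q, hq, hgq⟩ := hg (ENNReal.ofReal ε) (by simpa using hε)
  have h1 : q.1 X = 0 := (TwoSidedIdeal.mem_ker _).1 (hE hq)
  have h2 : ENNReal.ofReal ‖(g - q).1 X‖ < ENNReal.ofReal ε :=
    (le_iSup (fun X : Ball Λ => ENNReal.ofReal ‖(g - q).1 X‖) X).trans_lt hgq
  have h3 : (g - q).1 X = g.1 X := by
    change g.1 X - q.1 X = _
    rw [h1, sub_zero]
  rw [h3, ENNReal.ofReal_lt_ofReal_iff hε] at h2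
  linarith

lemma subset_of_isGeneratedBy {J : TwoSidedIdeal (discAlgebra Λ)}
    {E : Set (discAlgebra Λ)} (hgen : IsGeneratedBy J E) : E ⊆ J := by
  intro p hp
  rw [hgen]
  exact fun ε hε => ⟨p, TwoSidedIdeal.subset_span hp, by simpa [supNorm] using hε⟩

lemma mul_polyOf_mem {J : TwoSidedIdeal (discAlgebra Λ)} {k : ℕ} {S : Finset (List Λ)}
    {p : discAlgebra Λ} (hp : p ∈ J) {x : discAlgebra Λ} {v : S → ℂ}
    (hx : x - p * polyOf S v ∈ highDegree Λ k) :
    x ∈ J.asIdeal.restrictScalars ℂ ⊔ highDegree Λ k := by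
  rw [← add_sub_cancel (p * polyOf S v) x]
  exact Submodule.add_mem_sup (J.mul_mem_right _ _ hp) hx

variable [DecidableEq Λ]

lemma polyOf_single (S : Finset (List Λ)) (w : S) :
    polyOf S (Pi.single w 1) = monomial w.1 := by
  simp [polyOf, Fintype.linearCombination_apply_single]

lemma shift_mulVec_single (S : Finset (List Λ)) (i : Λ) (w : S) :
    shift S i *ᵥ Pi.single w 1 = if h : i :: w.1 ∈ S then Pi.single ⟨i :: w.1, h⟩ 1 else 0 := by
  rw [Matrix.mulVec_single_one]
  ext u
  rw [Matrix.col_apply, shift_apply]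
  split_ifs with h1 h2 h2
  · rw [Pi.single_apply, if_pos (Subtype.ext h1)]
  · exact (h2 (h1 ▸ u.2)).elim
  · rw [Pi.single_apply, if_neg fun e => h1 (congrArg Subtype.val e)]
  · rfl

/-- Truncation discards only words of length k + 1, so modulo degree > k the shift is left
multiplication by the coordinate. -/
lemma polyOf_shift {F : Finset Λ} {k : ℕ} {i : Λ} (hi : i ∈ F) (v : wordsBelow F (k + 1) → ℂ) :
    polyOf _ (shift (wordsBelow F (k + 1)) i *ᵥ v) - coord i * polyOf _ v ∈ highDegree Λ k := by
  let φ : (wordsBelow F (k + 1) → ℂ) →ₗ[ℂ] discAlgebra Λ :=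
    polyOf _ ∘ₗ (shift (wordsBelow F (k + 1)) i).mulVecLin -
      LinearMap.mulLeft ℂ (coord i) ∘ₗ polyOf _
  have h : (highDegree Λ k).mkQ ∘ₗ φ = 0 := by
    refine LinearMap.pi_ext' fun w => LinearMap.ext_ring ?_
    simp only [LinearMap.comp_apply, LinearMap.zero_apply, Submodule.mkQ_apply,
      Submodule.Quotient.mk_eq_zero, LinearMap.single_apply]
    change polyOf _ (shift _ i *ᵥ Pi.single w 1) - coord i * polyOf _ (Pi.single w 1) ∈ _
    rw [polyOf_single, shift_mulVec_single, ← monomial_cons]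
    split_ifs with h
    · rw [polyOf_single, sub_self]
      exact zero_mem _
    · rw [map_zero, zero_sub, Submodule.neg_mem_iff]
      refine Submodule.subset_span ⟨_, ?_, rfl⟩
      have hw := mem_wordsBelow.1 w.2
      by_contra hlen
      refine h (mem_wordsBelow.2 ⟨Nat.lt_succ_of_le (not_lt.1 hlen), ?_⟩)
      simpa using ⟨hi, hw.2⟩
  have h2 := LinearMap.congr_fun h v
  rwa [LinearMap.comp_apply, Submodule.mkQ_apply, LinearMap.zero_apply,
    Submodule.Quotient.mk_eq_zero] at h2

lemma polyOf_wordProd_shift {F : Finset Λ} {k : ℕ} {w : List Λ} (hw : ∀ i ∈ w, i ∈ F)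
    (v : wordsBelow F (k + 1) → ℂ) :
    polyOf _ (wordProd (shift (wordsBelow F (k + 1))) w *ᵥ v) - monomial w * polyOf _ v ∈
      highDegree Λ k := by
  induction w with
  | nil => simp [wordProd_nil, monomial]
  | cons i w ih =>
    simp only [List.mem_cons, forall_eq_or_imp] at hw
    rw [wordProd_cons, ← Matrix.mulVec_mulVec, monomial_cons, mul_assoc]
    have h1 := add_mem (polyOf_shift (k := k) hw.1 (wordProd (shift (wordsBelow F (k + 1))) w *ᵥ v))
      (coord_mul_mem_highDegree i (ih hw.2))
    rwa [mul_sub, sub_add_sub_cancel] at h1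

/-- A polynomial acts on the truncated shift as by multiplication, up to higher order terms. -/
lemma exists_matrix_of_mem_homogPoly {F : Finset Λ} {j k : ℕ} {X : Ball Λ} {r : ℂ}
    {B : Matrix (Fin X.1) (wordsBelow F (k + 1)) ℂ}
    (hB : ∀ w : List Λ, (∀ i ∈ w, i ∈ F) → wordProd X.2.1 w * B =
      r ^ w.length • (B * wordProd (shift (wordsBelow F (k + 1))) w))
    {p : discAlgebra Λ} (hp : p ∈ homogPoly F j) :
    ∃ A : Matrix (wordsBelow F (k + 1)) (wordsBelow F (k + 1)) ℂ,
      evalHom X p * B = r ^ j • (B * A) ∧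
        ∀ v, polyOf _ (A *ᵥ v) - p * polyOf _ v ∈ highDegree Λ k := by
  refine Submodule.span_induction ?_ ?_ ?_ ?_ hp
  · rintro _ ⟨w, rfl, hw, rfl⟩
    refine ⟨_, ?_, polyOf_wordProd_shift hw⟩
    rw [evalHom_monomial, hB w hw]
  · exact ⟨0, by simp, fun v => by simp⟩
  · rintro p q _ _ ⟨A, hA, hA'⟩ ⟨A₂, hA₂, hA₂'⟩
    refine ⟨A + A₂, ?_, fun v => ?_⟩
    · rw [map_add, Matrix.add_mul, hA, hA₂, Matrix.mul_add, smul_add]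
    · have := add_mem (hA' v) (hA₂' v)
      rwa [← add_sub_add_comm, ← map_add, ← add_mul, ← Matrix.add_mulVec] at this
  · rintro c p _ ⟨A, hA, hA'⟩
    refine ⟨c • A, ?_, fun v => ?_⟩
    · rw [map_smul, Matrix.smul_mul, hA, Matrix.mul_smul, smul_comm]
    · have := Submodule.smul_mem _ c (hA' v)
      rwa [smul_sub, ← map_smul, ← smul_mul_assoc, ← Matrix.smul_mulVec] at this

/-- For a suitably generated homogeneous ideal, the Taylor polynomials of a function in `A_d` that
vanishes on the zero locus agree with an element of the ideal up to terms of higher order. -/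
lemma exists_taylor_mem_sup {J : TwoSidedIdeal (discAlgebra Λ)} {E : Set (discAlgebra Λ)}
    (hgen : IsGeneratedBy J E) {F : Finset Λ}
    (hE : ∀ p ∈ E, (∃ j, p ∈ homogPoly F j) ∨ ∃ w, p = monomial w ∧ ∃ i ∈ w, i ∉ F)
    {f : discAlgebra Λ} (hf : f ∈ vanishing (zeroLocus (J : Set (discAlgebra Λ)))) (k : ℕ) :
    ∃ r : ℂ, r ≠ 0 ∧ ∑ w ∈ wordsBelow F (k + 1), (coeff f w * r ^ w.length) • monomial w ∈
      J.asIdeal.restrictScalars ℂ ⊔ highDegree Λ k := by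
  let S := wordsBelow F (k + 1)
  have hS : IsSuffixClosed S := isSuffixClosed_wordsBelow F k
  let N := J.asIdeal.restrictScalars ℂ ⊔ highDegree Λ k
  -- The kernel of B consists of the coefficient vectors of polynomials lying in J modulo degree >
  -- k.
  obtain ⟨n, B, C, hBC, hK⟩ := exists_matrix_ker (N.comap (polyOf S))
  -- The word operators applied to the empty word return the words themselves, modulo degree > k;
  -- the claim says that the Taylor polynomial dies in the quotient.
  suffices ∃ r : ℂ, r ≠ 0 ∧ B *ᵥ ∑ w ∈ S, (coeff f w * r ^ w.length) •
      (wordProd (shift S) w *ᵥ Pi.single ⟨[], hS.nil_mem⟩ 1) = 0 by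
    obtain ⟨r, hr, h⟩ := this
    refine ⟨r, hr, ?_⟩
    rw [hK, Submodule.mem_comap, map_sum] at h
    have h1 : ∑ w ∈ S, (polyOf S ((coeff f w * r ^ w.length) •
        (wordProd (shift S) w *ᵥ Pi.single ⟨[], hS.nil_mem⟩ 1)) -
        (coeff f w * r ^ w.length) • monomial w) ∈ N := by
      refine sum_mem fun w hw => Submodule.mem_sup_right ?_
      have := polyOf_wordProd_shift (k := k) (mem_wordsBelow.1 hw).2
        (Pi.single ⟨[], hS.nil_mem⟩ 1)
      rw [polyOf_single] at this
      rw [map_smul, ← smul_sub]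
      refine Submodule.smul_mem _ _ ?_
      simpa [monomial] using this
    rw [Finset.sum_sub_distrib] at h1
    exact (Submodule.sub_mem_iff_right _ h).1 h1
  -- A zero quotient gives no point of the ball, but then there is nothing to prove.
  rcases Nat.eq_zero_or_pos n with rfl | hn
  · exact ⟨1, one_ne_zero, Subsingleton.elim _ _⟩
  let X : Tuple Λ n := fun i => if i ∈ F then B * shift S i * C else 0
  have hXF : ∀ i ∉ F, X i = 0 := fun i hi => if_neg hi
  -- The kernel of B is invariant under the shifts: J absorbs multiplication from the left, and
  -- multiplication by a coordinate preserves degree > k.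
  have hstable {i : Λ} (hi : i ∈ F) {v : S → ℂ} (hv : B *ᵥ v = 0) : B *ᵥ (shift S i *ᵥ v) = 0 := by
    rw [hK, Submodule.mem_comap] at hv ⊢
    obtain ⟨x, hx, d, hd, hxd⟩ := Submodule.mem_sup.1 hv
    have h1 := polyOf_shift (k := k) hi v
    rw [← hxd, mul_add, ← sub_sub] at h1
    have h2 := add_mem h1 (coord_mul_mem_highDegree i hd)
    rw [sub_add_cancel] at h2
    have hx' : coord i * x ∈ J.asIdeal.restrictScalars ℂ := J.mul_mem_left (coord i) x hx
    have h3 := Submodule.add_mem_sup hx' h2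
    rwa [add_sub_cancel] at h3
  have hX1 {i : Λ} (hi : i ∈ F) : X i * B = B * shift S i := by
    simp only [X, if_pos hi]
    refine Matrix.ext_of_mulVec_single fun w => ?_
    have h1 : B *ᵥ ((C * B) *ᵥ Pi.single w 1 - Pi.single w 1) = 0 := by
      rw [Matrix.mulVec_sub, Matrix.mulVec_mulVec, ← Matrix.mul_assoc, hBC, Matrix.one_mul,
        sub_self]
    have h2 := hstable hi h1
    rw [Matrix.mulVec_sub, Matrix.mulVec_sub, sub_eq_zero] at h2
    rwa [Matrix.mulVec_mulVec, Matrix.mulVec_mulVec, Matrix.mulVec_mulVec, ← Matrix.mul_assoc]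
      at h2
  have hX2 (w : List Λ) (hw : ∀ i ∈ w, i ∈ F) : wordProd X w * B = B * wordProd (shift S) w := by
    induction w with
    | nil => simp [wordProd_nil]
    | cons i w ih =>
      simp only [List.mem_cons, forall_eq_or_imp] at hw
      rw [wordProd_cons, wordProd_cons, Matrix.mul_assoc, ih hw.2, ← Matrix.mul_assoc, hX1 hw.1,
        Matrix.mul_assoc]
  have hcancel {M : Matrix (Fin n) (Fin n) ℂ} (hM : M * B = 0) : M = 0 := by
    rw [← mul_one M, ← hBC, ← Matrix.mul_assoc, hM, Matrix.zero_mul]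
  obtain ⟨c, hc0, hc⟩ := exists_rowBound_of_finite X F hXF
  let r : ℂ := ((1 / (c + 1) : ℝ) : ℂ)
  have hrn : ‖r‖ = 1 / (c + 1) := by
    rw [Complex.norm_real, Real.norm_of_nonneg (by positivity)]
  have hr0 : r ≠ 0 := by
    rw [← norm_pos_iff, hrn]; positivity
  have hball : InBall (r • X) := by
    refine ⟨⟨⟨0, hn⟩⟩, _, by positivity, ?_, hc.smul r⟩
    rw [hrn, one_div, inv_mul_lt_iff₀ (by positivity)]
    linarith
  let P : Ball Λ := ⟨n, r • X, mem_ballLevel_iff.2 hball⟩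
  have hrX (w : List Λ) (hw : ∀ i ∈ w, i ∈ F) :
      wordProd (r • X) w * B = r ^ w.length • (B * wordProd (shift S) w) := by
    rw [wordProd_smul, Matrix.smul_mul, hX2 w hw]
  -- A generator p multiplies every polynomial into J from the left, so it acts as zero on the
  -- quotient. Homogeneity of p makes the scaling by r a single factor r^j.
  have hP : P ∈ zeroLocus (J : Set (discAlgebra Λ)) := by
    refine mem_zeroLocus_of_isGeneratedBy hgen fun p hp => ?_
    rcases hE p hp with ⟨j, hj⟩ | ⟨w, rfl, i, hiw, hiF⟩
    · obtain ⟨A, hA, hA'⟩ := exists_matrix_of_mem_homogPoly (X := P) hrX hj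
      refine hcancel (hA.trans ?_)
      have : B * A = 0 := Matrix.ext_of_mulVec_single fun w => by
        rw [← Matrix.mulVec_mulVec, Matrix.zero_mulVec, hK]
        exact mul_polyOf_mem (subset_of_isGeneratedBy hgen hp) (hA' _)
      rw [this, smul_zero]
    · rw [evalHom_monomial]
      exact wordProd_eq_zero (by simp [P, hXF i hiF]) hiw
  have h0 : evalAt f (r • X) = 0 := (evalAt_fin f P.2).trans (hf P hP)
  rw [evalAt_eq_sum f hS hball fun w hw i hi => ?_] at h0
  · refine ⟨r, hr0, ?_⟩
    rw [Matrix.mulVec_sum]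
    have h1 := congrArg (fun M => (M * B) *ᵥ Pi.single ⟨[], hS.nil_mem⟩ 1) h0
    simp only [Matrix.sum_mul, Matrix.sum_mulVec, Matrix.zero_mul, Matrix.zero_mulVec] at h1
    rw [← h1]
    refine Finset.sum_congr rfl fun w hw => ?_
    rw [Matrix.smul_mul, hrX w (mem_wordsBelow.1 hw).2, smul_smul, Matrix.smul_mulVec,
      Matrix.mulVec_smul, Matrix.mulVec_mulVec]
  · by_cases hiF : i ∈ F
    · have hw' := mem_wordsBelow.1 hw
      have hall : ∀ j ∈ i :: w, j ∈ F := by simpa using ⟨hiF, hw'.2⟩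
      have hlen : k < (i :: w).length := by
        by_contra h
        exact hi (mem_wordsBelow.2 ⟨Nat.lt_succ_of_le (not_lt.1 h), hall⟩)
      refine hcancel ?_
      rw [hrX _ hall]
      have : B * wordProd (shift S) (i :: w) = 0 := Matrix.ext_of_mulVec_single fun u => by
        rw [← Matrix.mulVec_mulVec, Matrix.zero_mulVec, hK]
        have h1 := add_mem (polyOf_wordProd_shift (k := k) hall (Pi.single u 1))
          (monomial_mul_polyOf_mem hlen S (Pi.single u 1))
        rw [sub_add_cancel] at h1
        exact Submodule.mem_sup_right h1
      rw [this, smul_zero]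
    · exact wordProd_eq_zero (by simp [hXF i hiF]) List.mem_cons_self

lemma taylor_mem {J : TwoSidedIdeal (discAlgebra Λ)} (hhomog : IsHomogeneousIdeal J)
    {E : Set (discAlgebra Λ)} (hgen : IsGeneratedBy J E) {F : Finset Λ}
    (hE : ∀ p ∈ E, (∃ j, p ∈ homogPoly F j) ∨ ∃ w, p = monomial w ∧ ∃ i ∈ w, i ∉ F)
    {f : discAlgebra Λ} (hf : f ∈ vanishing (zeroLocus (J : Set (discAlgebra Λ)))) (k : ℕ) :
    taylor f F k ∈ J := by
  obtain ⟨r, hr, h⟩ := exists_taylor_mem_sup hgen hE hf k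
  obtain ⟨x, hx, d, hd, hxd⟩ := Submodule.mem_sup.1 h
  obtain ⟨g, hg, hgx⟩ := hhomog x hx k
  -- Words of length below k and above k drop out, so the component of x in degree k is exactly the
  -- rescaled Taylor part.
  have h1 : homogLin k x = (r ^ k • taylor f F k : discAlgebra Λ).1 := by
    have h2 := congrArg (homogLin k) hxd
    rw [map_add, homogLin_highDegree hd, add_zero] at h2
    rw [h2, map_sum, sum_wordsBelow, Finset.sum_range_succ, Finset.sum_eq_zero, zero_add]
    · have h3 : r ^ k • taylor f F k = ∑ w ∈ words F k, (coeff f w * r ^ k) • monomial w := by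
        rw [taylor, Finset.smul_sum]
        exact Finset.sum_congr rfl fun w _ => by rw [smul_smul, mul_comm]
      rw [h3, AddSubmonoidClass.coe_finsetSum]
      refine Finset.sum_congr rfl fun w hw => ?_
      rw [map_smul, homogLin_monomial, if_pos (mem_words.1 hw).1, (mem_words.1 hw).1]
      rfl
    · intro j hj
      refine Finset.sum_eq_zero fun w hw => ?_
      rw [map_smul, homogLin_monomial, if_neg, smul_zero]
      rw [(mem_words.1 hw).1]
      exact (Finset.mem_range.1 hj).ne
  have h2 : r ^ k • taylor f F k = g := Subtype.ext (h1.symm.trans hgx.symm)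
  have h3 : taylor f F k = (r ^ k)⁻¹ • g := by
    rw [← h2, smul_smul, inv_mul_cancel₀ (pow_ne_zero _ hr), one_smul]
  rw [h3]
  exact (J.asIdeal.restrictScalars ℂ).smul_mem _ hg

/-- If cofinally many finite sets of variables are compatible with the generators, then the ideal
consists of the functions that vanish on its zero locus. -/
lemma vanishing_zeroLocus_subset {J : TwoSidedIdeal (discAlgebra Λ)} (hclosed : IsClosedIdeal J)
    (hhomog : IsHomogeneousIdeal J) {E : Set (discAlgebra Λ)} (hgen : IsGeneratedBy J E)
    (F₀ : Finset Λ) (hE : ∀ F, F₀ ⊆ F → ∀ p ∈ E,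
      (∃ j, p ∈ homogPoly F j) ∨ ∃ w, p = monomial w ∧ ∃ i ∈ w, i ∉ F) :
    vanishing (zeroLocus (J : Set (discAlgebra Λ))) ⊆ J := by
  intro f hf
  rw [← hclosed]
  intro ε hε
  obtain ⟨δ, hδ0, hδε⟩ := ENNReal.lt_iff_exists_nnreal_btwn.1 hε
  have hδ : (0 : ℝ) < δ := by exact_mod_cast hδ0
  obtain ⟨r, m, G₀, h⟩ := exists_taylor_approx f hδ
  refine ⟨∑ k ∈ Finset.range m, r ^ k • taylor f (G₀ ∪ F₀) k, ?_, ?_⟩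
  · change _ ∈ J.asIdeal.restrictScalars ℂ
    refine sum_mem fun k _ => Submodule.smul_mem _ _ ?_
    exact taylor_mem hhomog hgen (hE _ Finset.subset_union_right) hf k
  · refine lt_of_le_of_lt (iSup_le fun X => ?_) hδε
    rw [← ENNReal.ofReal_coe_nnreal]
    exact ENNReal.ofReal_le_ofReal (h _ Finset.subset_union_left X)

end algebra

end NCBall

end

theorem mainTheorem4 {Λ : Type*} (J : TwoSidedIdeal (NCBall.discAlgebra Λ))
    (hclosed : NCBall.IsClosedIdeal J) (hhomog : NCBall.IsHomogeneousIdeal J)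
    (hgen :
      (∃ W : Set (List Λ), NCBall.IsGeneratedBy J (NCBall.monomial '' W)) ∨
      (∃ (Λ' : Finset Λ) (E : Set (NCBall.discAlgebra Λ)),
        (∀ p ∈ E, ∃ k : ℕ, p ∈ NCBall.homogPoly Λ' k) ∧ NCBall.IsGeneratedBy J E)) :
    (J : Set (NCBall.discAlgebra Λ)) =
      NCBall.vanishing (NCBall.zeroLocus (J : Set (NCBall.discAlgebra Λ))) := by
  classical
  refine Set.Subset.antisymm (fun f hf X hX => hX f hf) ?_
  rcases hgen with ⟨W, hW⟩ | ⟨Λ', E, hE, hgen⟩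
  · refine NCBall.vanishing_zeroLocus_subset hclosed hhomog hW ∅ ?_
    rintro F - _ ⟨w, -, rfl⟩
    -- Any finite F is compatible with monomial generators: a monomial either uses letters of F
    -- only, or has a letter outside F.
    by_cases hw : ∀ i ∈ w, i ∈ F
    · exact Or.inl ⟨w.length, Submodule.subset_span ⟨w, rfl, hw, rfl⟩⟩
    · push Not at hw
      exact Or.inr ⟨w, rfl, hw⟩
  · refine NCBall.vanishing_zeroLocus_subset hclosed hhomog hgen Λ' fun F hF p hp => Or.inl ?_
    obtain ⟨k, hk⟩ := hE p hp
    refine ⟨k, Submodule.span_mono ?_ hk⟩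
    rintro _ ⟨w, hw, hw', rfl⟩
    exact ⟨w, hw, fun i hi => hF (hw' i hi), rfl⟩
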